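/- Let $n\ge 1$, $T>0$, $a_0,\dots,a_{2n-1}\in L^1([0,T])$ real-valued, and $Lu=u^{(2n)}+a_{2n-1}u^{(2n-1)}+\dots+a_1u'+a_0u$ on $[0,T]$. Let $\widetilde L$ be the operator of the same form on $[0,2T]$ whose coefficients are the extensions of the $a_k$ by reflection about $t=T$, even if $k$ is even and odd if $k$ is odd: the $k$-th coefficient is $a_k(t)$ for $0\le t\le T$ and $(-1)^k a_k(2T-t)$ for $T<t\le 2T$. Let $\widetilde{\widetilde L}$ on $[0,4T]$ be obtained from $\widetilde L$ in the same way, by reflection about $t=2T$. For $S>0$ let $W^{2n,1}([0,S])$ be the set of $u\in C^{2n-1}([0,S])$ with $u^{(2n-1)}$ absolutely continuous, and let $X_{N,S}, X_{D,S}, X_{M_1,S}, X_{M_2,S}, X_{P,S}, X_{A,S}$ be its subspaces given by the following boundary conditions (with $0\le k\le n-1$ in the first four and $0\le k\le 2n-1$ in the last two): * Neumann ($N$): $u^{(2k+1)}(0)=u^{(2k+1)}(S)=0$; * Dirichlet ($D$): $u^{(2k)}(0)=u^{(2k)}(S)=0$; * mixed 1 ($M_1$): $u^{(2k+1)}(0)=u^{(2k)}(S)=0$;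 * mixed 2 ($M_2$): $u^{(2k)}(0)=u^{(2k+1)}(S)=0$; * periodic ($P$): $u^{(k)}(0)=u^{(k)}(S)$; * antiperiodic ($A$): $u^{(k)}(0)=-u^{(k)}(S)$. Let $S\in\{T,2T,4T\}$ and let $L_S$ be $L$, $\widetilde L$, $\widetilde{\widetilde L}$ respectively. For $Y\in\{N,D,M_1,M_2,P,A\}$, the problem $(Y,S)$ is called nonresonant if the only $u\in X_{Y,S}$ with $L_Su=0$ a.e. on $[0,S]$ is $u=0$. A Green's function of $(Y,S)$ is a continuous function $G_Y[S]$ on $[0,S]\times[0,S]$ such that for each $\sigma\in L^1([0,S])$ the function $u(t)=\int_0^S G_Y[S](t,s)\,\sigma(s)\,ds$ belongs to $X_{Y,S}$ and satisfies $L_Su=\sigma$ a.e. on $[0,S]$. If $(Y,S)$ is nonresonant, then $G_Y[S]$ exists and is unique. Moreover, for all $(t,s)\in[0,T]\times[0,T]$, each of the following formulas holds whenever all the problems whose Green's functions occur in it are nonresonant. 1. Neumann: $$\begin{aligned}G_N[T](t,s)&=G_P[2T](t,s)+G_P[2T](2T-t,s),\\ G_N[T](t,s)&=G_N[2T](t,s)+G_N[2T](2T-t,s),\\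 G_N[T](t,s)&=G_P[4T](t,s)+G_P[4T](4T-t,s)+G_P[4T](2T-t,s)+G_P[4T](2T+t,s).\end{aligned}$$ 2. Dirichlet: $$\begin{aligned}G_D[T](t,s)&=G_P[2T](t,s)-G_P[2T](2T-t,s),\\ G_D[T](t,s)&=G_D[2T](t,s)-G_D[2T](2T-t,s),\\ G_D[T](t,s)&=G_P[4T](t,s)-G_P[4T](4T-t,s)-G_P[4T](2T-t,s)+G_P[4T](2T+t,s).\end{aligned}$$ 3. Mixed: $$\begin{aligned}G_{M_1}[T](t,s)&=G_A[2T](t,s)-G_A[2T](2T-t,s),\\ G_{M_2}[T](t,s)&=G_A[2T](t,s)+G_A[2T](2T-t,s),\\ G_{M_1}[T](t,s)&=G_N[2T](t,s)-G_N[2T](2T-t,s),\\ G_{M_2}[T](t,s)&=G_D[2T](t,s)+G_D[2T](2T-t,s),\\ G_{M_1}[T](t,s)&=G_P[4T](t,s)+G_P[4T](4T-t,s)-G_P[4T](2T-t,s)-G_P[4T](2T+t,s),\\ G_{M_2}[T](t,s)&=G_P[4T](t,s)-G_P[4T](4T-t,s)+G_P[4T](2T-t,s)-G_P[4T](2T+t,s).\end{aligned}$$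 4. Connecting relations: $$\begin{aligned}G_P[2T](t,s)&=\tfrac12\left(G_N[T](t,s)+G_D[T](t,s)\right), & G_P[2T](2T-t,s)&=\tfrac12\left(G_N[T](t,s)-G_D[T](t,s)\right),\\ G_A[2T](t,s)&=\tfrac12\left(G_{M_2}[T](t,s)+G_{M_1}[T](t,s)\right), & G_A[2T](2T-t,s)&=\tfrac12\left(G_{M_2}[T](t,s)-G_{M_1}[T](t,s)\right),\\ G_N[2T](t,s)&=\tfrac12\left(G_N[T](t,s)+G_{M_1}[T](t,s)\right), & G_N[2T](2T-t,s)&=\tfrac12\left(G_N[T](t,s)-G_{M_1}[T](t,s)\right),\\ G_D[2T](t,s)&=\tfrac12\left(G_{M_2}[T](t,s)+G_D[T](t,s)\right), & G_D[2T](2T-t,s)&=\tfrac12\left(G_{M_2}[T](t,s)-G_D[T](t,s)\right),\end{aligned}$$ $$G_P[4T](t,s)=\tfrac14\left(G_N[T](t,s)+G_D[T](t,s)+G_{M_1}[T](t,s)+G_{M_2}[T](t,s)\right).$$ In the two-term connecting relations, both formulas of a line hold under nonresonance of the three problems named in that line. -/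

import Mathlib

open MeasureTheory Set

/-- The Sobolev space `W^{2n,1}([0,T])` (for `n ≥ 1`): functions of class `C^{2n-1}` on `[0,T]` whose
derivative of order `2n-1` is absolutely continuous on `[0,T]`. Only the values on `[0,T]` matter;
derivatives at the endpoints are one-sided. -/
def sobolevW (n : ℕ) (T : ℝ) : Set (ℝ → ℝ) :=
  {u | ContDiffOn ℝ ((2 * n - 1 : ℕ) : WithTop ℕ∞) u (Icc 0 T) ∧
    AbsolutelyContinuousOnInterval (iteratedDerivWithin (2 * n - 1) u (Icc 0 T)) 0 T}

/-- The differential operator of order `2n` on `[0,T]` with coefficients `a 0, …, a (2n-1)`: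
`L u = u^(2n) + a_{2n-1} u^(2n-1) + … + a_1 u' + a_0 u`. -/
noncomputable def diffOp (n : ℕ) (T : ℝ) (a : Fin (2 * n) → ℝ → ℝ) (u : ℝ → ℝ) (t : ℝ) : ℝ :=
  iteratedDerivWithin (2 * n) u (Icc 0 T) t +
    ∑ k : Fin (2 * n), a k t * iteratedDerivWithin (k : ℕ) u (Icc 0 T) t

/-- `L u = σ` almost everywhere on `[0,T]`. -/
def SolvesAE (n : ℕ) (T : ℝ) (a : Fin (2 * n) → ℝ → ℝ) (u σ : ℝ → ℝ) : Prop :=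
  ∀ᵐ t ∂(volume.restrict (Icc 0 T)), diffOp n T a u t = σ t

/-- Coefficients on `[0,2T]` obtained from coefficients on `[0,T]` by reflection about `t = T`:
the even extension for those of even index, the odd extension for those of odd index. -/
noncomputable def extendCoeff {n : ℕ} (T : ℝ) (a : Fin (2 * n) → ℝ → ℝ) :
    Fin (2 * n) → ℝ → ℝ :=
  fun k t => if t ≤ T then a k t else (-1) ^ (k : ℕ) * a k (2 * T - t)

/-- The types of two-point boundary conditions. -/
inductive BoundaryCondition
  | neumann
  | dirichlet
  | mixed1
  | mixed2
  | periodic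
  | antiperiodic

/-- The boundary conditions of order `2n` on `[0,T]` for a function `u`. -/
def BoundaryCondition.Holds (b : BoundaryCondition) (n : ℕ) (T : ℝ) (u : ℝ → ℝ) : Prop :=
  match b with
  | .neumann => ∀ k < n, iteratedDerivWithin (2 * k + 1) u (Icc 0 T) 0 = 0 ∧
      iteratedDerivWithin (2 * k + 1) u (Icc 0 T) T = 0
  | .dirichlet => ∀ k < n, iteratedDerivWithin (2 * k) u (Icc 0 T) 0 = 0 ∧
      iteratedDerivWithin (2 * k) u (Icc 0 T) T = 0
  | .mixed1 => ∀ k < n, iteratedDerivWithin (2 * k + 1) u (Icc 0 T) 0 = 0 ∧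
      iteratedDerivWithin (2 * k) u (Icc 0 T) T = 0
  | .mixed2 => ∀ k < n, iteratedDerivWithin (2 * k) u (Icc 0 T) 0 = 0 ∧
      iteratedDerivWithin (2 * k + 1) u (Icc 0 T) T = 0
  | .periodic => ∀ k < 2 * n, iteratedDerivWithin k u (Icc 0 T) 0 =
      iteratedDerivWithin k u (Icc 0 T) T
  | .antiperiodic => ∀ k < 2 * n, iteratedDerivWithin k u (Icc 0 T) 0 =
      -iteratedDerivWithin k u (Icc 0 T) T

/-- The space `X` of functions in `W^{2n,1}([0,T])` satisfying the boundary conditions `b`. -/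
def bvpSpace (b : BoundaryCondition) (n : ℕ) (T : ℝ) : Set (ℝ → ℝ) :=
  {u | u ∈ sobolevW n T ∧ b.Holds n T u}

/-- The operator with coefficients `a` on `[0,T]` is nonresonant in the space of the boundary
conditions `b`: the homogeneous problem has only the trivial solution. -/
def Nonresonant (b : BoundaryCondition) (n : ℕ) (T : ℝ) (a : Fin (2 * n) → ℝ → ℝ) : Prop :=
  ∀ u ∈ bvpSpace b n T, SolvesAE n T a u (fun _ => 0) → ∀ t ∈ Icc 0 T, u t = 0

/-- `G` is a Green's function of the operator with coefficients `a` on `[0,T]` and boundary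
conditions `b`: it is continuous on the square `[0,T] × [0,T]`, and for each `σ ∈ L¹([0,T])` the
function `u t = ∫₀ᵀ G t s * σ s ds` is a solution of `L u = σ` a.e. with `u ∈ X`. -/
structure IsGreenFunction (b : BoundaryCondition) (n : ℕ) (T : ℝ) (a : Fin (2 * n) → ℝ → ℝ)
    (G : ℝ → ℝ → ℝ) : Prop where
  continuousOn : ContinuousOn (fun p : ℝ × ℝ => G p.1 p.2) (Icc 0 T ×ˢ Icc 0 T)
  mem_space : ∀ σ : ℝ → ℝ, IntegrableOn σ (Icc 0 T) →
    (fun t => ∫ s in (0 : ℝ)..T, G t s * σ s) ∈ bvpSpace b n T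
  solves : ∀ σ : ℝ → ℝ, IntegrableOn σ (Icc 0 T) →
    SolvesAE n T a (fun t => ∫ s in (0 : ℝ)..T, G t s * σ s) σ

/-- `G` is a Green's function, and any other one agrees with it on `[0,T] × [0,T]`. -/
def IsUniqueGreenFunction (b : BoundaryCondition) (n : ℕ) (T : ℝ) (a : Fin (2 * n) → ℝ → ℝ)
    (G : ℝ → ℝ → ℝ) : Prop :=
  IsGreenFunction b n T a G ∧ ∀ G' : ℝ → ℝ → ℝ, IsGreenFunction b n T a G' →
    ∀ t ∈ Icc 0 T, ∀ s ∈ Icc 0 T, G' t s = G t s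

open Classical in
/-- The Green's function of the operator with coefficients `a` on `[0,T]` and boundary conditions
`b`. Only its values on `[0,T] × [0,T]` are meaningful (and `0` is a junk value, used only if
there is no Green's function). -/
noncomputable def greenFunction (b : BoundaryCondition) (n : ℕ) (T : ℝ)
    (a : Fin (2 * n) → ℝ → ℝ) : ℝ → ℝ → ℝ :=
  if h : ∃ G : ℝ → ℝ → ℝ, IsGreenFunction b n T a G then h.choose else fun _ _ => 0

/-! The formulas rest on folding. Given `σ` on `[0,T]`, extend it by zero to `[0,2T]`, let `u` solve
the problem there, and put `v(t) = u(t) + ε u(2T - t)` with `ε = ±1`. Reflection multiplies the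
`k`-th derivative by `(-1)^k`, which is also the sign by which the extended coefficients differ
across `T`. Hence the reflected function solves `L w = 0` on `(0,T)`, and `L v = σ` there. At `T`
the odd derivatives of `v` cancel if `ε = 1` and the even ones if `ε = -1`; at `0` the conditions on
`u` give those on `v` (`BoundaryCondition.FoldsTo`). So `G(t,s) + ε G(2T - t,s)` is a Green's
function on `[0,T]` (`IsGreenFunction.fold`), and by `IsGreenFunction.unique` it is the expected
one. Two folds give the formulas on `[0,4T]`; the connecting relations are linear combinations of
the others.

Existence (`Nonresonant.exists_isGreenFunction`) comes from the companion system. Picard iteration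
gives a fundamental matrix and its inverse, and variation of constants turns the boundary conditions
into a square linear system for the initial jet. Nonresonance makes that system injective, hence
invertible.

Since the coefficients are only integrable, the argument runs on chains of absolutely continuous
primitives (`IsJet`), and `mem_bvpSpace_solvesAE_iff` translates to and from `iteratedDerivWithin`.
-/

/-! ### Absolutely continuous primitives -/

/-- `f` is absolutely continuous on `[a,b]` and has derivative `g` almost everywhere there. -/
structure IsPrimitiveOn (f g : ℝ → ℝ) (a b : ℝ) : Prop where
  ac : AbsolutelyContinuousOnInterval f a b
  ae_hasDerivAt : ∀ᵐ t, t ∈ Ioo a b → HasDerivAt f (g t) t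

theorem AbsolutelyContinuousOnInterval.congr_of_eqOn {f g : ℝ → ℝ} {a b : ℝ}
    (hf : AbsolutelyContinuousOnInterval f a b) (h : EqOn f g (uIcc a b)) :
    AbsolutelyContinuousOnInterval g a b := by
  rw [absolutelyContinuousOnInterval_iff] at hf ⊢
  intro ε hε
  obtain ⟨δ, hδ, H⟩ := hf ε hε
  refine ⟨δ, hδ, fun E hE hE' => ?_⟩
  have := H E hE hE'
  rwa [Finset.sum_congr rfl fun i hi => ?_] at this
  rw [h (hE.1 i hi).1, h (hE.1 i hi).2]

theorem AbsolutelyContinuousOnInterval.of_const (c a b : ℝ) :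
    AbsolutelyContinuousOnInterval (fun _ => c) a b :=
  ((LipschitzWith.const c).lipschitzOnWith).absolutelyContinuousOnInterval

theorem HasDerivAt.congr_of_eqOn_Ioo {f g : ℝ → ℝ} {f' a b t : ℝ} (hf : HasDerivAt f f' t)
    (h : EqOn f g (Icc a b)) (ht : t ∈ Ioo a b) : HasDerivAt g f' t :=
  hf.congr_of_eventuallyEq <| by
    filter_upwards [Ioo_mem_nhds ht.1 ht.2] with s hs using (h (Ioo_subset_Icc_self hs)).symm

namespace IsPrimitiveOn

variable {f f' g g' : ℝ → ℝ} {a b c d : ℝ}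

theorem congr_left (hf : IsPrimitiveOn f f' a b) (hab : a ≤ b) (h : EqOn f g (Icc a b)) :
    IsPrimitiveOn g f' a b where
  ac := hf.ac.congr_of_eqOn (by rwa [uIcc_of_le hab])
  ae_hasDerivAt := by
    filter_upwards [hf.ae_hasDerivAt] with t ht hm using (ht hm).congr_of_eqOn_Ioo h hm

theorem congr_right (hf : IsPrimitiveOn f f' a b) (h : ∀ᵐ t, t ∈ Ioo a b → f' t = g' t) :
    IsPrimitiveOn f g' a b where
  ac := hf.ac
  ae_hasDerivAt := by
    filter_upwards [hf.ae_hasDerivAt, h] with t ht h' hm using h' hm ▸ ht hm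

theorem congr_right_eqOn (hf : IsPrimitiveOn f f' a b) (h : EqOn f' g' (Icc a b)) :
    IsPrimitiveOn f g' a b :=
  hf.congr_right (.of_forall fun _ ht => h (Ioo_subset_Icc_self ht))

theorem mono (hf : IsPrimitiveOn f f' a b) (hac : a ≤ c) (hcd : c ≤ d) (hdb : d ≤ b) :
    IsPrimitiveOn f f' c d where
  ac := hf.ac.mono (by
    rw [uIcc_of_le hcd, uIcc_of_le (hac.trans (hcd.trans hdb))]; exact Icc_subset_Icc hac hdb)
  ae_hasDerivAt := by
    filter_upwards [hf.ae_hasDerivAt] with t ht hm using ht ⟨hac.trans_lt hm.1, hm.2.trans_le hdb⟩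

theorem of_integral (hg : IntervalIntegrable g volume a b) (hab : a ≤ b) {c : ℝ}
    (h : ∀ t ∈ Icc a b, f t = c + ∫ s in a..t, g s) : IsPrimitiveOn f g a b := by
  have h1 : IsPrimitiveOn (fun t => c + ∫ s in a..t, g s) g a b :=
    { ac := (AbsolutelyContinuousOnInterval.of_const c a b).fun_add
        (hg.absolutelyContinuousOnInterval_intervalIntegral left_mem_uIcc)
      ae_hasDerivAt := by
        filter_upwards [hg.ae_hasDerivAt_integral] with t ht hm
        exact (ht (by rw [uIcc_of_le hab]; exact Ioo_subset_Icc_self hm) a left_mem_uIcc).const_add c }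
  exact h1.congr_left hab fun t ht => (h t ht).symm

theorem ae_deriv_eq (hf : IsPrimitiveOn f f' a b) (hab : a ≤ b) :
    deriv f =ᵐ[volume.restrict (uIoc a b)] f' := by
  rw [uIoc_of_le hab, ← restrict_Ioo_eq_restrict_Ioc, Filter.EventuallyEq,
    ae_restrict_iff' measurableSet_Ioo]
  filter_upwards [hf.ae_hasDerivAt] with t ht hm using (ht hm).deriv

theorem intervalIntegrable (hf : IsPrimitiveOn f f' a b) (hab : a ≤ b) :
    IntervalIntegrable f' volume a b :=
  hf.ac.intervalIntegrable_deriv.congr_ae (hf.ae_deriv_eq hab)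

theorem integral_eq (hf : IsPrimitiveOn f f' a b) (hab : a ≤ b) :
    ∫ s in a..b, f' s = f b - f a := by
  rw [← hf.ac.integral_deriv_eq_sub]
  exact (intervalIntegral.integral_congr_ae_restrict (hf.ae_deriv_eq hab)).symm

theorem eq_integral (hf : IsPrimitiveOn f f' a b) {t : ℝ} (ht : t ∈ Icc a b) :
    f t = f a + ∫ s in a..t, f' s := by
  rw [(hf.mono le_rfl ht.1 ht.2).integral_eq ht.1]; ring

theorem continuousOn (hf : IsPrimitiveOn f f' a b) (hab : a ≤ b) : ContinuousOn f (Icc a b) := by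
  simpa [uIcc_of_le hab] using hf.ac.continuousOn

theorem const (c a b : ℝ) : IsPrimitiveOn (fun _ => c) (fun _ => 0) a b where
  ac := .of_const c a b
  ae_hasDerivAt := .of_forall fun t _ => hasDerivAt_const t c

theorem add (hf : IsPrimitiveOn f f' a b) (hg : IsPrimitiveOn g g' a b) :
    IsPrimitiveOn (fun t => f t + g t) (fun t => f' t + g' t) a b where
  ac := hf.ac.fun_add hg.ac
  ae_hasDerivAt := by
    filter_upwards [hf.ae_hasDerivAt, hg.ae_hasDerivAt] with t h1 h2 hm using (h1 hm).add (h2 hm)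

theorem mul (hf : IsPrimitiveOn f f' a b) (hg : IsPrimitiveOn g g' a b) :
    IsPrimitiveOn (fun t => f t * g t) (fun t => f' t * g t + f t * g' t) a b where
  ac := hf.ac.fun_mul hg.ac
  ae_hasDerivAt := by
    filter_upwards [hf.ae_hasDerivAt, hg.ae_hasDerivAt] with t h1 h2 hm using (h1 hm).mul (h2 hm)

theorem const_mul (r : ℝ) (hf : IsPrimitiveOn f f' a b) :
    IsPrimitiveOn (fun t => r * f t) (fun t => r * f' t) a b := by
  simpa using (const r a b).mul hf

theorem sum {ι : Type*} {F F' : ι → ℝ → ℝ} (s : Finset ι)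
    (h : ∀ i ∈ s, IsPrimitiveOn (F i) (F' i) a b) :
    IsPrimitiveOn (fun t => ∑ i ∈ s, F i t) (fun t => ∑ i ∈ s, F' i t) a b := by
  classical
  induction s using Finset.induction_on with
  | empty => simpa using const 0 a b
  | insert i s hi ih =>
    simpa only [Finset.sum_insert hi] using (h i (by simp)).add
      (ih fun j hj => h j (Finset.mem_insert_of_mem hj))

theorem pow (hf : IsPrimitiveOn f f' a b) (m : ℕ) :
    IsPrimitiveOn (fun t => f t ^ (m + 1)) (fun t => (m + 1) * f t ^ m * f' t) a b := by
  induction m with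
  | zero => simpa using hf
  | succ m ih =>
    have := (ih.mul hf).congr_right (g' := fun t => ((m + 1 : ℕ) + 1) * f t ^ (m + 1) * f' t)
      (.of_forall fun t _ => by push_cast; ring)
    simpa only [pow_succ _ (m + 1)] using this

/-- A change of variables in the integral representation replaces the chain rule for almost
everywhere derivatives. -/
theorem comp_sub_left (hf : IsPrimitiveOn f f' 0 b) (hb : 0 ≤ b) :
    IsPrimitiveOn (fun t => f (b - t)) (fun t => -f' (b - t)) 0 b := by
  have hi := hf.intervalIntegrable hb
  refine of_integral (c := f b) ?_ hb fun t ht => ?_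
  · have h := (hi.comp_sub_left b).symm.neg
    rw [sub_self, sub_zero] at h
    exact h
  · have h1 := (hf.mono (sub_nonneg.2 ht.2) (sub_le_self b ht.1) le_rfl).integral_eq
      (sub_le_self b ht.1)
    rw [intervalIntegral.integral_neg, intervalIntegral.integral_comp_sub_left f' b, sub_zero, h1]
    ring

theorem eq_of_zero (hf : IsPrimitiveOn f f' a b) (h : ∀ t ∈ Icc a b, f' t = 0) {t : ℝ}
    (ht : t ∈ Icc a b) : f t = f a := by
  rw [hf.eq_integral ht, intervalIntegral.integral_congr (g := fun _ => 0)]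
  · simp
  · intro s hs
    rw [uIcc_of_le ht.1] at hs
    exact h s ⟨hs.1, hs.2.trans ht.2⟩

/-- As `f` is the integral of a continuous function, the almost everywhere derivative becomes a
derivative at every point, one-sided at the ends. This is the link from primitives to
`iteratedDerivWithin`. -/
theorem hasDerivWithinAt (hf : IsPrimitiveOn f f' a b) (hc : ContinuousOn f' (Icc a b))
    {t : ℝ} (ht : t ∈ Icc a b) : HasDerivWithinAt f (f' t) (Icc a b) t := by
  have : Fact (t ∈ Icc a b) := ⟨ht⟩
  have h := intervalIntegral.integral_hasDerivWithinAt_right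
    ((hf.mono le_rfl ht.1 ht.2).intervalIntegrable ht.1) (s := Icc a b) (t := Icc a b)
    (hc.stronglyMeasurableAtFilter_nhdsWithin measurableSet_Icc t) (hc t ht)
  exact (h.const_add (f a)).congr (fun s hs => hf.eq_integral hs) (hf.eq_integral ht)

end IsPrimitiveOn

/-! ### Linear systems with integrable coefficients -/

theorem intervalIntegrable_finset_sum {κ : Type*} {F : κ → ℝ → ℝ} {a b : ℝ} (s : Finset κ)
    (h : ∀ i ∈ s, IntervalIntegrable (F i) volume a b) :
    IntervalIntegrable (fun t => ∑ i ∈ s, F i t) volume a b := by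
  have := IntervalIntegrable.sum s h
  rwa [Finset.sum_fn] at this

theorem intervalIntegrable_sum_abs {ι : Type*} [Fintype ι] {T : ℝ} {A : ι → ι → ℝ → ℝ}
    (hA : ∀ i j, IntervalIntegrable (A i j) volume 0 T) :
    IntervalIntegrable (fun s => ∑ i, ∑ j, |A i j s|) volume 0 T :=
  intervalIntegrable_finset_sum _ fun i _ => intervalIntegrable_finset_sum _ fun j _ => (hA i j).abs

section LinearSystem

variable {ι : Type*} [Fintype ι] {T : ℝ} (hT : 0 ≤ T) {A : ι → ι → ℝ → ℝ}

theorem intervalIntegrable_linear_apply (hA : ∀ i j, IntervalIntegrable (A i j) volume 0 T)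
    (y : C(Icc 0 T, ι → ℝ)) (i : ι) :
    IntervalIntegrable (fun s => ∑ j, A i j s * y (projIcc 0 T hT s) j) volume 0 T := by
  refine intervalIntegrable_finset_sum _ fun j _ =>
    (hA i j).mul_continuousOn (Continuous.continuousOn ?_)
  exact (continuous_apply j).comp (y.continuous.comp continuous_projIcc)

/-- The Picard operator of the linear system `x' = A x` on `[0,T]` with initial value `x₀`. -/
noncomputable def linearPicard (hA : ∀ i j, IntervalIntegrable (A i j) volume 0 T) (x₀ : ι → ℝ)
    (y : C(Icc 0 T, ι → ℝ)) : C(Icc 0 T, ι → ℝ) where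
  toFun t i := x₀ i + ∫ s in 0..(t : ℝ), ∑ j, A i j s * y (projIcc 0 T hT s) j
  continuous_toFun := continuous_pi fun i => by
    have h := (IsPrimitiveOn.of_integral (c := x₀ i) (intervalIntegrable_linear_apply hT hA y i) hT
      fun t _ => rfl).continuousOn hT
    exact continuousOn_iff_continuous_domRestrict.1 h

/-- With `α(t) = ∫₀ᵗ μ`, each Picard step integrates the previous bound against `μ`, and `α^m μ /
m!` is the derivative of `α^(m+1) / (m+1)!`. -/
theorem dist_linearPicard_iterate_le (hA : ∀ i j, IntervalIntegrable (A i j) volume 0 T)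
    (x₀ : ι → ℝ) (y z : C(Icc 0 T, ι → ℝ)) (m : ℕ) (t : Icc 0 T) :
    dist ((linearPicard hT hA x₀)^[m] y t) ((linearPicard hT hA x₀)^[m] z t) ≤
      (∫ s in 0..(t : ℝ), ∑ i, ∑ j, |A i j s|) ^ m / m.factorial * dist y z := by
  set μ : ℝ → ℝ := fun s => ∑ i, ∑ j, |A i j s|
  have hμ0 : ∀ s, 0 ≤ μ s := fun s =>
    Finset.sum_nonneg fun i _ => Finset.sum_nonneg fun j _ => abs_nonneg _
  have hμi : IntervalIntegrable μ volume 0 T := intervalIntegrable_sum_abs hA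
  have hα : IsPrimitiveOn (fun t => ∫ s in 0..t, μ s) μ 0 T :=
    .of_integral (c := 0) hμi hT fun t _ => by simp
  induction m generalizing t with
  | zero => simpa using ContinuousMap.dist_apply_le_dist (f := y) (g := z) t
  | succ m ih =>
    rw [Function.iterate_succ_apply', Function.iterate_succ_apply']
    set Y := (linearPicard hT hA x₀)^[m] y
    set Z := (linearPicard hT hA x₀)^[m] z
    -- The bound to be proved, in primitive form: its derivative dominates the integrand below, so
    -- the integral of that derivative is known exactly.
    have hpow := ((hα.pow m).const_mul (dist y z / (m + 1).factorial)).mono le_rfl t.2.1 t.2.2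
    have hint := hpow.intervalIntegrable t.2.1
    have hval := hpow.integral_eq t.2.1
    have hnn : 0 ≤ (∫ s in 0..(t : ℝ), μ s) ^ (m + 1) / (m + 1).factorial * dist y z := by
      have : 0 ≤ ∫ s in 0..(t : ℝ), μ s := intervalIntegral.integral_nonneg t.2.1 fun s _ => hμ0 s
      positivity
    refine (dist_pi_le_iff hnn).2 fun i => ?_
    have hsub : ∀ w : C(Icc 0 T, ι → ℝ), IntervalIntegrable
        (fun s => ∑ j, A i j s * w (projIcc 0 T hT s) j) volume 0 t := fun w =>
      (intervalIntegrable_linear_apply hT hA w i).mono_set (by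
        rw [uIcc_of_le t.2.1, uIcc_of_le hT]; exact Icc_subset_Icc le_rfl t.2.2)
    calc dist (linearPicard hT hA x₀ Y t i) (linearPicard hT hA x₀ Z t i)
        = ‖∫ s in 0..(t : ℝ), (∑ j, A i j s * Y (projIcc 0 T hT s) j -
            ∑ j, A i j s * Z (projIcc 0 T hT s) j)‖ := by
          rw [intervalIntegral.integral_sub (hsub Y) (hsub Z), dist_eq_norm]
          simp [linearPicard]
      _ ≤ ∫ s in 0..(t : ℝ), dist y z / (m + 1).factorial *
            ((m + 1) * (∫ r in 0..s, μ r) ^ m * μ s) := by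
          refine intervalIntegral.norm_integral_le_of_norm_le t.2.1 (.of_forall fun s hs => ?_) hint
          have hsT : s ∈ Icc 0 T := ⟨hs.1.le, hs.2.trans t.2.2⟩
          rw [projIcc_of_mem hT hsT, ← Finset.sum_sub_distrib]
          have hα0 : 0 ≤ ∫ r in 0..s, μ r :=
            intervalIntegral.integral_nonneg hs.1.le fun s _ => hμ0 s
          calc ‖∑ j, (A i j s * Y ⟨s, hsT⟩ j - A i j s * Z ⟨s, hsT⟩ j)‖
              ≤ ∑ j, |A i j s| * ((∫ r in 0..s, μ r) ^ m / m.factorial * dist y z) := by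
                refine norm_sum_le_of_le _ fun j _ => ?_
                rw [← mul_sub, norm_mul]
                refine mul_le_mul_of_nonneg_left ?_ (abs_nonneg _)
                rw [← dist_eq_norm]
                exact (dist_le_pi_dist _ _ j).trans (ih ⟨s, hsT⟩)
            _ ≤ μ s * ((∫ r in 0..s, μ r) ^ m / m.factorial * dist y z) := by
                rw [← Finset.sum_mul]
                refine mul_le_mul_of_nonneg_right ?_ (by positivity)
                exact Finset.single_le_sum (f := fun i => ∑ j, |A i j s|)
                  (fun i _ => Finset.sum_nonneg fun j _ => abs_nonneg _) (Finset.mem_univ i)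
            _ = _ := by
                rw [Nat.factorial_succ]; push_cast
                field_simp
      _ = _ := by
          rw [hval]; simp; ring

/-- The factorial beats the power, so some iterate of the Picard operator is a contraction on the
whole of `[0,T]`; its unique fixed point is also fixed by the operator itself. -/
theorem exists_linear_solution (hT : 0 ≤ T) (hA : ∀ i j, IntervalIntegrable (A i j) volume 0 T)
    (x₀ : ι → ℝ) : ∃ x : ι → ℝ → ℝ, ∀ i, x i 0 = x₀ i ∧
      IsPrimitiveOn (x i) (fun t => ∑ j, A i j t * x j t) 0 T := by
  obtain ⟨m, hm⟩ := FloorSemiring.tendsto_pow_div_factorial_atTop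
    (∫ s in 0..T, ∑ i, ∑ j, |A i j s|) |>.eventually (gt_mem_nhds zero_lt_one) |>.exists
  have hμ0 : ∀ s, 0 ≤ ∑ i, ∑ j, |A i j s| := fun s =>
    Finset.sum_nonneg fun i _ => Finset.sum_nonneg fun j _ => abs_nonneg _
  have hμi := intervalIntegrable_sum_abs hA
  have hK : 0 ≤ (∫ s in 0..T, ∑ i, ∑ j, |A i j s|) ^ m / m.factorial := by
    have : 0 ≤ ∫ s in 0..T, ∑ i, ∑ j, |A i j s| :=
      intervalIntegral.integral_nonneg hT fun s _ => hμ0 s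
    positivity
  have hc : ContractingWith ⟨_, hK⟩ (linearPicard hT hA x₀)^[m] := by
    refine ⟨hm, LipschitzWith.of_dist_le_mul fun y z => ?_⟩
    refine (ContinuousMap.dist_le (mul_nonneg hK dist_nonneg)).2 fun t => ?_
    refine (dist_linearPicard_iterate_le hT hA x₀ y z m t).trans ?_
    have h1 : ∫ s in 0..(t : ℝ), ∑ i, ∑ j, |A i j s| ≤ ∫ s in 0..T, ∑ i, ∑ j, |A i j s| :=
      intervalIntegral.integral_mono_interval le_rfl t.2.1 t.2.2 (.of_forall hμ0) hμi
    have h0 : 0 ≤ ∫ s in 0..(t : ℝ), ∑ i, ∑ j, |A i j s| :=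
      intervalIntegral.integral_nonneg t.2.1 fun s _ => hμ0 s
    change _ ≤ (∫ s in 0..T, ∑ i, ∑ j, |A i j s|) ^ m / m.factorial * dist y z
    gcongr
  set y := ContractingWith.fixedPoint _ hc
  have hy : linearPicard hT hA x₀ y = y := hc.isFixedPt_fixedPoint_iterate
  refine ⟨fun i t => y (projIcc 0 T hT t) i, fun i => ⟨?_, ?_⟩⟩
  · change y (projIcc 0 T hT 0) i = _
    rw [← hy]
    simp [linearPicard]
  · refine .of_integral (c := x₀ i) (intervalIntegrable_linear_apply hT hA y i) hT fun t ht => ?_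
    change y (projIcc 0 T hT t) i = _
    conv_lhs => rw [projIcc_of_mem hT ht, ← hy]
    rfl

variable [DecidableEq ι]

/-- Fundamental matrix of a linear system together with its inverse. -/
structure IsFundamentalPair (A Φ Ψ : ι → ι → ℝ → ℝ) (T : ℝ) : Prop where
  primitive : ∀ i k, IsPrimitiveOn (Φ i k) (fun t => ∑ j, A i j t * Φ j k t) 0 T
  primitive_inv : ∀ i k, IsPrimitiveOn (Ψ i k) (fun t => -∑ j, Ψ i j t * A j k t) 0 T
  zero : ∀ i k, Φ i k 0 = if i = k then 1 else 0
  mul_inv : ∀ t ∈ Icc 0 T, ∀ i k, ∑ j, Φ i j t * Ψ j k t = if i = k then 1 else 0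

/-- The columns of `X` solve `x' = A x` and the rows of `Z` solve the adjoint system `z' = -z A`.
Then `(Z X)' = -Z A X + Z A X = 0`, so `Z X` keeps its initial value, the identity. The derivative
of `X Z` does not cancel in this way, so `X Z = 1` is taken from the commutation of one-sided
inverses of square matrices. -/
theorem exists_isFundamentalPair (hT : 0 ≤ T) (hA : ∀ i j, IntervalIntegrable (A i j) volume 0 T) :
    ∃ Φ Ψ : ι → ι → ℝ → ℝ, IsFundamentalPair A Φ Ψ T := by
  choose X hX using fun k : ι =>
    exists_linear_solution hT hA (fun i => if i = k then 1 else 0)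
  choose Z hZ using fun k : ι =>
    exists_linear_solution hT (A := fun i j t => -A j i t) (fun i j => (hA j i).neg)
      (fun i => if i = k then 1 else 0)
  have hZ' : ∀ i k, IsPrimitiveOn (Z i k) (fun t => -∑ j, Z i j t * A j k t) 0 T := fun i k =>
    (hZ i k).2.congr_right_eqOn fun t _ => by
      simp [mul_comm]
  have hprod : ∀ t ∈ Icc 0 T, ∀ i k, ∑ j, Z i j t * X k j t = if i = k then 1 else 0 := by
    intro t ht i k
    have h : IsPrimitiveOn (fun t => ∑ j, Z i j t * X k j t) _ 0 T :=
      IsPrimitiveOn.sum Finset.univ fun j _ => (hZ' i j).mul (hX k j).2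
    rw [h.eq_of_zero (fun s _ => ?_) ht]
    · simp [(hZ _ _).1, (hX _ _).1, eq_comm]
    · simp only [Finset.sum_add_distrib, neg_mul, Finset.sum_neg_distrib, Finset.sum_mul,
        Finset.mul_sum]
      rw [Finset.sum_comm, neg_add_eq_zero]
      exact Finset.sum_congr rfl fun _ _ => Finset.sum_congr rfl fun _ _ => by ring
  refine ⟨fun i k => X k i, Z, fun i k => (hX k i).2, hZ', fun i k => (hX k i).1, ?_⟩
  intro t ht
  have h1 : (Matrix.of fun i k => Z i k t) * (Matrix.of fun i k => X k i t) = 1 := by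
    ext i k
    simpa [Matrix.mul_apply, Matrix.one_apply] using hprod t ht i k
  have h2 := mul_eq_one_comm.1 h1
  intro i k
  simpa [Matrix.mul_apply, Matrix.one_apply] using congrFun (congrFun h2 i) k

/-- By the product rule `(Φ y)' = A Φ y + Φ Ψ f`, and `Φ Ψ = 1`. -/
theorem IsFundamentalPair.variation_of_constants {Φ Ψ : ι → ι → ℝ → ℝ} {y f : ι → ℝ → ℝ}
    (h : IsFundamentalPair A Φ Ψ T)
    (hy : ∀ k, IsPrimitiveOn (y k) (fun t => ∑ j, Ψ k j t * f j t) 0 T) (i : ι) :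
    IsPrimitiveOn (fun t => ∑ k, Φ i k t * y k t)
      (fun t => ∑ j, A i j t * ∑ k, Φ j k t * y k t + f i t) 0 T := by
  refine (IsPrimitiveOn.sum Finset.univ fun k _ => (h.primitive i k).mul (hy k)).congr_right_eqOn
    fun t ht => ?_
  simp only [Finset.sum_add_distrib, Finset.sum_mul, Finset.mul_sum]
  congr 1
  · rw [Finset.sum_comm]
    exact Finset.sum_congr rfl fun _ _ => Finset.sum_congr rfl fun _ _ => by ring
  · rw [Finset.sum_comm]
    calc ∑ j, ∑ k, Φ i k t * (Ψ k j t * f j t) = ∑ j, (∑ k, Φ i k t * Ψ k j t) * f j t := by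
          simp only [Finset.sum_mul, mul_assoc]
      _ = f i t := by simp [h.mul_inv t ht]

end LinearSystem

/-! ### Chains of derivatives and boundary value problems -/

/-- The functions `x 0, …, x N` form a chain of successive primitives on `[0,T]` starting at `u`;
only the last one may be defined merely almost everywhere. -/
structure IsJet (N : ℕ) (T : ℝ) (u : ℝ → ℝ) (x : ℕ → ℝ → ℝ) : Prop where
  zero : EqOn (x 0) u (Icc 0 T)
  primitive : ∀ i < N, IsPrimitiveOn (x i) (x (i + 1)) 0 T

namespace IsJet

variable {N n : ℕ} {T : ℝ} {u : ℝ → ℝ} {x : ℕ → ℝ → ℝ}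

theorem continuousOn (h : IsJet N T u x) (hT : 0 ≤ T) {i : ℕ} (hi : i < N) :
    ContinuousOn (x i) (Icc 0 T) :=
  (h.primitive i hi).continuousOn hT

theorem hasDerivWithinAt (h : IsJet N T u x) {i : ℕ} (hi : i + 1 < N) {t : ℝ}
    (ht : t ∈ Icc 0 T) : HasDerivWithinAt (x i) (x (i + 1) t) (Icc 0 T) t :=
  (h.primitive i (by omega)).hasDerivWithinAt (h.continuousOn (ht.1.trans ht.2) hi) ht

theorem iteratedDerivWithin_eq (h : IsJet N T u x) (hT : 0 < T) {i : ℕ} (hi : i < N) :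
    EqOn (iteratedDerivWithin i u (Icc 0 T)) (x i) (Icc 0 T) := by
  induction i with
  | zero => simpa using h.zero.symm
  | succ i ih =>
    intro t ht
    rw [iteratedDerivWithin_succ, derivWithin_congr (ih (by omega)) (ih (by omega) ht)]
    exact (h.hasDerivWithinAt hi ht).derivWithin (uniqueDiffOn_Icc hT t ht)

theorem mem_sobolevW (h : IsJet (2 * n) T u x) (hn : 1 ≤ n) (hT : 0 < T) : u ∈ sobolevW n T := by
  refine ⟨(contDiffOn_nat_iff_continuousOn_differentiableOn_deriv (uniqueDiffOn_Icc hT)).2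
    ⟨fun m hm => ?_, fun m hm => ?_⟩, ?_⟩
  · exact (h.continuousOn hT.le (by omega)).congr (h.iteratedDerivWithin_eq hT (by omega))
  · exact DifferentiableOn.congr (f := x m)
      (fun t ht => (h.hasDerivWithinAt (by omega) ht).differentiableWithinAt)
      (h.iteratedDerivWithin_eq hT (by omega))
  · refine (h.primitive (2 * n - 1) (by omega)).ac.congr_of_eqOn ?_
    rw [uIcc_of_le hT.le]
    exact (h.iteratedDerivWithin_eq hT (by omega)).symm

theorem ae_iteratedDerivWithin_eq (h : IsJet (N + 1) T u x) (hT : 0 < T) :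
    ∀ᵐ t, t ∈ Ioo 0 T → iteratedDerivWithin (N + 1) u (Icc 0 T) t = x (N + 1) t := by
  filter_upwards [(h.primitive N N.lt_succ_self).ae_hasDerivAt] with t ht hm
  rw [iteratedDerivWithin_succ, derivWithin_of_mem_nhds (Icc_mem_nhds hm.1 hm.2)]
  exact ((ht hm).congr_of_eqOn_Ioo (h.iteratedDerivWithin_eq hT N.lt_succ_self).symm hm).deriv

/-- Derivatives of order below `2n - 1` are of class `C¹`, hence absolutely continuous; that of
order `2n - 1` is so by definition of the space. -/
theorem of_mem_sobolevW (hu : u ∈ sobolevW n T) (hT : 0 < T) :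
    IsJet (2 * n) T u (fun i => iteratedDerivWithin i u (Icc 0 T)) := by
  refine ⟨fun t _ => by simp, fun i hi => ?_⟩
  have hU := uniqueDiffOn_Icc hT
  have hac : AbsolutelyContinuousOnInterval (iteratedDerivWithin i u (Icc 0 T)) 0 T := by
    rcases Nat.lt_or_ge i (2 * n - 1) with h | h
    · refine ContDiffOn.absolutelyContinuousOnInterval ?_
      rw [uIcc_of_le hT.le]
      exact ((contDiffOn_nat_succ_iff_contDiffOn_one_iteratedDerivWithin hU).1
        (hu.1.of_le (by exact_mod_cast h))).2
    · obtain rfl : i = 2 * n - 1 := by omega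
      exact hu.2
  refine ⟨hac, ?_⟩
  filter_upwards [hac.ae_differentiableAt] with t ht hm
  rw [iteratedDerivWithin_succ, derivWithin_of_mem_nhds (Icc_mem_nhds hm.1 hm.2)]
  exact (ht (by rw [uIcc_of_le hT.le]; exact Ioo_subset_Icc_self hm)).hasDerivAt

theorem solvesAE_iff (h : IsJet (2 * n) T u x) (hn : 1 ≤ n) (hT : 0 < T)
    {a : Fin (2 * n) → ℝ → ℝ} {σ : ℝ → ℝ} : SolvesAE n T a u σ ↔
      ∀ᵐ t, t ∈ Ioo 0 T → x (2 * n) t + ∑ k : Fin (2 * n), a k t * x k t = σ t := by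
  rw [SolvesAE, ← restrict_Ioo_eq_restrict_Icc, ae_restrict_iff' measurableSet_Ioo]
  have htop : ∀ᵐ t, t ∈ Ioo 0 T → iteratedDerivWithin (2 * n) u (Icc 0 T) t = x (2 * n) t := by
    obtain ⟨m, hm⟩ : ∃ m, 2 * n = m + 1 := ⟨2 * n - 1, by omega⟩
    rw [hm] at h ⊢
    exact h.ae_iteratedDerivWithin_eq hT
  refine Filter.eventually_congr ?_
  filter_upwards [htop] with t ht
  refine forall_congr' fun hm => ?_
  rw [diffOp, ht hm, Finset.sum_congr rfl fun k _ => by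
    rw [h.iteratedDerivWithin_eq hT k.2 (Ioo_subset_Icc_self hm)]]

end IsJet

/-- The boundary conditions in terms of the derivatives `p k` at `0` and `q k` at the right end. -/
def BoundaryCondition.JetHolds (b : BoundaryCondition) (n : ℕ) (p q : ℕ → ℝ) : Prop :=
  match b with
  | .neumann => ∀ k < n, p (2 * k + 1) = 0 ∧ q (2 * k + 1) = 0
  | .dirichlet => ∀ k < n, p (2 * k) = 0 ∧ q (2 * k) = 0
  | .mixed1 => ∀ k < n, p (2 * k + 1) = 0 ∧ q (2 * k) = 0
  | .mixed2 => ∀ k < n, p (2 * k) = 0 ∧ q (2 * k + 1) = 0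
  | .periodic => ∀ k < 2 * n, p k = q k
  | .antiperiodic => ∀ k < 2 * n, p k = -q k

theorem BoundaryCondition.JetHolds.congr {b : BoundaryCondition} {n : ℕ} {p q p' q' : ℕ → ℝ}
    (h : b.JetHolds n p q) (hp : ∀ k < 2 * n, p k = p' k) (hq : ∀ k < 2 * n, q k = q' k) :
    b.JetHolds n p' q' := by
  cases b
  case periodic => exact fun k hk => by rw [← hp k hk, ← hq k hk, h k hk]
  case antiperiodic => exact fun k hk => by rw [← hp k hk, ← hq k hk, h k hk]
  all_goals
    refine fun k hk => ?_
    rw [← hp _ (by omega), ← hq _ (by omega)]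
    exact h k hk

theorem IsJet.holds_iff {n : ℕ} {T : ℝ} {u : ℝ → ℝ} {x : ℕ → ℝ → ℝ} (h : IsJet (2 * n) T u x)
    (hT : 0 < T) (b : BoundaryCondition) :
    b.Holds n T u ↔ b.JetHolds n (fun k => x k 0) (fun k => x k T) := by
  have h0 := fun k (hk : k < 2 * n) => h.iteratedDerivWithin_eq hT hk (left_mem_Icc.2 hT.le)
  have h1 := fun k (hk : k < 2 * n) => h.iteratedDerivWithin_eq hT hk (right_mem_Icc.2 hT.le)
  have : b.Holds n T u ↔ b.JetHolds n (fun k => iteratedDerivWithin k u (Icc 0 T) 0)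
      (fun k => iteratedDerivWithin k u (Icc 0 T) T) := by cases b <;> rfl
  rw [this]
  exact ⟨fun H => H.congr h0 h1,
    fun H => H.congr (fun k hk => (h0 k hk).symm) (fun k hk => (h1 k hk).symm)⟩

/-- Solutions of boundary value problems in terms of jets. -/
theorem mem_bvpSpace_solvesAE_iff {b : BoundaryCondition} {n : ℕ} (hn : 1 ≤ n) {T : ℝ} (hT : 0 < T)
    {a : Fin (2 * n) → ℝ → ℝ} {u σ : ℝ → ℝ} :
    (u ∈ bvpSpace b n T ∧ SolvesAE n T a u σ) ↔ ∃ x : ℕ → ℝ → ℝ, IsJet (2 * n) T u x ∧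
      b.JetHolds n (fun k => x k 0) (fun k => x k T) ∧
      ∀ᵐ t, t ∈ Ioo 0 T → x (2 * n) t + ∑ k : Fin (2 * n), a k t * x k t = σ t := by
  constructor
  · rintro ⟨⟨hu, hb⟩, hs⟩
    have hj := IsJet.of_mem_sobolevW hu hT
    exact ⟨_, hj, (hj.holds_iff hT b).1 hb, (hj.solvesAE_iff hn hT).1 hs⟩
  · rintro ⟨x, hj, hb, hs⟩
    exact ⟨⟨hj.mem_sobolevW hn hT, (hj.holds_iff hT b).2 hb⟩, (hj.solvesAE_iff hn hT).2 hs⟩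

/-! ### Companion system and boundary conditions as linear equations -/

/-- The companion matrix of `u^(2n) + a_{2n-1} u^(2n-1) + … + a_0 u`. -/
noncomputable def companionMatrix {n : ℕ} (a : Fin (2 * n) → ℝ → ℝ) (i j : Fin (2 * n)) (t : ℝ) :
    ℝ :=
  if (i : ℕ) + 1 = 2 * n then -a j t else if (j : ℕ) = i + 1 then 1 else 0

theorem intervalIntegrable_companionMatrix {n : ℕ} {T : ℝ} {a : Fin (2 * n) → ℝ → ℝ}
    (ha : ∀ k, IntervalIntegrable (a k) volume 0 T) (i j : Fin (2 * n)) :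
    IntervalIntegrable (companionMatrix a i j) volume 0 T := by
  unfold companionMatrix
  split_ifs
  · exact (ha j).neg
  · exact intervalIntegrable_const
  · exact intervalIntegrable_const

theorem exists_isJet_of_companionMatrix {n : ℕ} (hn : 1 ≤ n) {T : ℝ}
    {a : Fin (2 * n) → ℝ → ℝ} {σ : ℝ → ℝ} {x : Fin (2 * n) → ℝ → ℝ}
    (hx : ∀ i, IsPrimitiveOn (x i) (fun t => ∑ j, companionMatrix a i j t * x j t +
      if (i : ℕ) + 1 = 2 * n then σ t else 0) 0 T) :
    ∃ X : ℕ → ℝ → ℝ, IsJet (2 * n) T (x ⟨0, by omega⟩) X ∧ (∀ i : Fin (2 * n), X i = x i) ∧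
      ∀ t, X (2 * n) t + ∑ k : Fin (2 * n), a k t * X k t = σ t := by
  -- The chain is continued to order `2n` by solving the equation for the top derivative, so the
  -- equation holds at every point.
  refine ⟨fun k t => if h : k < 2 * n then x ⟨k, h⟩ t else σ t - ∑ j, a j t * x j t,
    ⟨fun t _ => ?_, fun i hi => ?_⟩, fun i => ?_, fun t => ?_⟩
  · have : 0 < 2 * n := by omega
    simp [this]
  · have h := (hx ⟨i, hi⟩)
    simp only [hi, dif_pos]
    refine h.congr_right_eqOn fun t _ => ?_
    by_cases hl : i + 1 = 2 * n
    · simp [companionMatrix, hl]; ring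
    · have h2 : i + 1 < 2 * n := by omega
      simp only [companionMatrix, hl, h2, if_false, dif_pos, add_zero, ite_mul, one_mul, zero_mul]
      rw [Finset.sum_eq_single ⟨i + 1, h2⟩] <;> simp +contextual [Fin.ext_iff]
  · ext t; simp
  · simp

/-- Boundary conditions of order `2n` are given by `2n` linear equations. -/
theorem BoundaryCondition.exists_linearMap_jetHolds_iff (b : BoundaryCondition) (n : ℕ) :
    ∃ B C : (Fin (2 * n) → ℝ) →ₗ[ℝ] (Fin (2 * n) → ℝ), ∀ p q : ℕ → ℝ,
      b.JetHolds n p q ↔ B (fun i => p i) + C (fun i => q i) = 0 := by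
  -- The four separated conditions differ only in the parities `c` at `0` and `d` at the right end.
  -- Row `2k` of the system carries the condition on `p`, row `2k + 1` the one on `q`.
  have key : ∀ c d : ℕ, c < 2 → d < 2 →
      ∃ B C : (Fin (2 * n) → ℝ) →ₗ[ℝ] (Fin (2 * n) → ℝ), ∀ p q : ℕ → ℝ,
        (∀ k < n, p (2 * k + c) = 0 ∧ q (2 * k + d) = 0) ↔
          B (fun i => p i) + C (fun i => q i) = 0 := by
    intro c d hc hd
    refine ⟨LinearMap.pi fun i => if (i : ℕ) % 2 = 0 then
        LinearMap.proj ⟨2 * ((i : ℕ) / 2) + c, by omega⟩ else 0,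
      LinearMap.pi fun i => if (i : ℕ) % 2 = 0 then 0 else
        LinearMap.proj ⟨2 * ((i : ℕ) / 2) + d, by omega⟩, fun p q => ?_⟩
    constructor
    · intro H
      ext i
      have := H ((i : ℕ) / 2) (by omega)
      by_cases hi : (i : ℕ) % 2 = 0 <;> simp [hi, this]
    · intro H k hk
      have h0 := congrFun H ⟨2 * k, by omega⟩
      have h1 := congrFun H ⟨2 * k + 1, by omega⟩
      have e : (2 * k + 1) / 2 = k := by omega
      have e' : (2 * k + 1) % 2 = 1 := by omega
      simp [e, e'] at h0 h1
      exact ⟨h0, h1⟩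
  cases b
  case neumann => exact key 1 1 (by omega) (by omega)
  case dirichlet => exact key 0 0 (by omega) (by omega)
  case mixed1 => exact key 1 0 (by omega) (by omega)
  case mixed2 => exact key 0 1 (by omega) (by omega)
  case periodic =>
    refine ⟨LinearMap.id, -LinearMap.id, fun p q => ?_⟩
    simp only [JetHolds, funext_iff, Fin.forall_iff]
    simp [← sub_eq_add_neg, sub_eq_zero]
  case antiperiodic =>
    refine ⟨LinearMap.id, LinearMap.id, fun p q => ?_⟩
    simp only [JetHolds, funext_iff, Fin.forall_iff]
    simp [← eq_neg_iff_add_eq_zero]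

/-! ### Existence of Green's functions -/

section Existence

variable {n : ℕ} {T : ℝ} {a : Fin (2 * n) → ℝ → ℝ} {Φ Ψ : Fin (2 * n) → Fin (2 * n) → ℝ → ℝ}

theorem IsFundamentalPair.intervalIntegrable_inv_mul (h : IsFundamentalPair (companionMatrix a) Φ Ψ T)
    (hT : 0 ≤ T) {σ : ℝ → ℝ} (hσ : IntervalIntegrable σ volume 0 T) (k l : Fin (2 * n)) :
    IntervalIntegrable (fun s => Ψ k l s * σ s) volume 0 T :=
  hσ.continuousOn_mul (by
    rw [uIcc_of_le hT]; exact (h.primitive_inv k l).continuousOn hT)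

/-- Variation of constants with initial jet `c`. The forcing sits in the last component of the
system, so only the last column of `Ψ` enters. -/
theorem IsFundamentalPair.exists_isJet (h : IsFundamentalPair (companionMatrix a) Φ Ψ T)
    (hn : 1 ≤ n) (hT : 0 ≤ T) {σ : ℝ → ℝ} (hσ : IntervalIntegrable σ volume 0 T)
    (c : Fin (2 * n) → ℝ) :
    ∃ X : ℕ → ℝ → ℝ, IsJet (2 * n) T (fun t => ∑ k, Φ ⟨0, by omega⟩ k t *
        (c k + ∫ s in 0..t, Ψ k ⟨2 * n - 1, by omega⟩ s * σ s)) X ∧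
      (∀ i : Fin (2 * n), X i 0 = c i) ∧
      (∀ i : Fin (2 * n), X i T = ∑ k, Φ i k T *
        (c k + ∫ s in 0..T, Ψ k ⟨2 * n - 1, by omega⟩ s * σ s)) ∧
      ∀ t, X (2 * n) t + ∑ k : Fin (2 * n), a k t * X k t = σ t := by
  set l : Fin (2 * n) := ⟨2 * n - 1, by omega⟩ with hl
  have hl' : ∀ i : Fin (2 * n), (i : ℕ) + 1 = 2 * n ↔ i = l := fun i => by
    rw [hl, Fin.ext_iff]; simp only; omega
  have hy : ∀ k, IsPrimitiveOn (fun t => c k + ∫ s in 0..t, Ψ k l s * σ s)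
      (fun t => ∑ j, Ψ k j t * (if (j : ℕ) + 1 = 2 * n then σ t else 0)) 0 T := fun k => by
    simp only [hl', mul_ite, mul_zero, Finset.sum_ite_eq', Finset.mem_univ, if_true]
    exact .of_integral (h.intervalIntegrable_inv_mul hT hσ k l) hT fun t _ => rfl
  obtain ⟨X, hX, hXx, hXs⟩ := exists_isJet_of_companionMatrix hn (fun i =>
    h.variation_of_constants (f := fun (j : Fin (2 * n)) t => if (j : ℕ) + 1 = 2 * n then σ t else 0) hy i)
  refine ⟨X, hX, fun i => ?_, fun i => by rw [hXx], hXs⟩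
  rw [hXx]
  simp [h.zero]

/-- The linear map that takes the initial jet of a solution of `L u = 0` to its jet at `T`. -/
noncomputable def transferMap (Φ : Fin (2 * n) → Fin (2 * n) → ℝ → ℝ) (T : ℝ) :
    (Fin (2 * n) → ℝ) →ₗ[ℝ] (Fin (2 * n) → ℝ) :=
  (Matrix.of fun i k => Φ i k T).mulVecLin

theorem transferMap_apply (c : Fin (2 * n) → ℝ) (i : Fin (2 * n)) :
    transferMap Φ T c i = ∑ k, Φ i k T * c k := by
  simp [transferMap, Matrix.mulVec, dotProduct]

/-- A kernel vector is the initial jet of a homogeneous solution satisfying `b`. Nonresonance makes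
that solution vanish, and with it all its derivatives at `0`. -/
theorem Nonresonant.injective_boundaryMap {b : BoundaryCondition} (hb : Nonresonant b n T a)
    (h : IsFundamentalPair (companionMatrix a) Φ Ψ T) (hn : 1 ≤ n) (hT : 0 < T)
    {B C : (Fin (2 * n) → ℝ) →ₗ[ℝ] (Fin (2 * n) → ℝ)}
    (hBC : ∀ p q : ℕ → ℝ, b.JetHolds n p q ↔ B (fun i => p i) + C (fun i => q i) = 0) :
    Function.Injective (B + C ∘ₗ transferMap Φ T) := by
  rw [← LinearMap.ker_eq_bot, LinearMap.ker_eq_bot']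
  intro c hc
  obtain ⟨X, hX, hX0, hXT, hXs⟩ :=
    h.exists_isJet hn hT.le (σ := fun _ => 0) intervalIntegrable_const c
  have hT' : (fun i : Fin (2 * n) => X i T) = transferMap Φ T c := by
    ext i; rw [hXT, transferMap_apply]; simp
  have hsol := (mem_bvpSpace_solvesAE_iff hn hT).2 ⟨X, hX, (hBC _ _).2 (by
    simp only [hX0, hT']; exact hc), .of_forall fun t _ => hXs t⟩
  have hz : EqOn _ (fun _ => (0 : ℝ)) (Icc 0 T) := hb _ hsol.1 hsol.2
  ext i
  rw [← hX0, ← hX.iteratedDerivWithin_eq hT i.2 (left_mem_Icc.2 hT.le),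
    iteratedDerivWithin_congr hz (left_mem_Icc.2 hT.le)]
  simp

/-- With `w = ∫₀ᵀ Ψ_l σ`, where `Ψ_l` is the last column of `Ψ`, the jet at `T` is `Φ(T)(c + w)`.
The boundary conditions read `B c + C Φ(T)(c + w) = 0`, with the unique solution `c = κ w`.
Inserting this `c` in the variation of constants formula and collecting the factors of `σ` yields
the kernel. -/
theorem Nonresonant.exists_isGreenFunction {b : BoundaryCondition} (hb : Nonresonant b n T a)
    (hn : 1 ≤ n) (hT : 0 < T) (ha : ∀ k, IntegrableOn (a k) (Icc 0 T)) :
    ∃ G : ℝ → ℝ → ℝ, IsGreenFunction b n T a G := by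
  obtain ⟨Φ, Ψ, h⟩ := exists_isFundamentalPair hT.le (intervalIntegrable_companionMatrix fun k =>
    (intervalIntegrable_iff_integrableOn_Icc_of_le hT.le).2 (ha k))
  obtain ⟨B, C, hBC⟩ := b.exists_linearMap_jetHolds_iff n
  have hinj := hb.injective_boundaryMap h hn hT hBC
  set M := LinearEquiv.ofInjectiveEndo _ hinj with hM
  set κ : (Fin (2 * n) → ℝ) →ₗ[ℝ] (Fin (2 * n) → ℝ) :=
    -(M.symm.toLinearMap ∘ₗ C ∘ₗ transferMap Φ T) with hκ
  have hκB : ∀ w, B (κ w) + C (transferMap Φ T (κ w + w)) = 0 := fun w => by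
    have : M (κ w) = -C (transferMap Φ T w) := by simp [hκ]
    rw [map_add, map_add, ← add_assoc]
    change M (κ w) + _ = 0
    rw [this, neg_add_cancel]
  set z : Fin (2 * n) := ⟨0, by omega⟩ with hz
  set l : Fin (2 * n) := ⟨2 * n - 1, by omega⟩ with hl
  -- First and last components differ because `2n ≥ 2`; hence the `(z,l)` entry of `Φ Ψ = 1` is
  -- zero.
  have hzl : z ≠ l := by rw [hz, hl, Ne, Fin.ext_iff]; simp only; omega
  set q : Fin (2 * n) → Fin (2 * n) → ℝ := fun k j => κ (fun i => if j = i then 1 else 0) k with hq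
  have hκq : ∀ w k, κ w k = ∑ j, q k j * w j := fun w k => by
    rw [LinearMap.pi_apply_eq_sum_univ κ w]
    simp [hq, mul_comm]
  have hΦc : ∀ i k, ContinuousOn (Φ i k) (Icc 0 T) := fun i k => (h.primitive i k).continuousOn hT.le
  have hΨc : ∀ i k, ContinuousOn (Ψ i k) (Icc 0 T) := fun i k =>
    (h.primitive_inv i k).continuousOn hT.le
  -- The `q` term encodes `κ`. The other term should be cut off for `s > t`; writing `min s t` does
  -- this, since there it becomes the vanishing entry of `Φ(t) Ψ(t)`. Continuity across the diagonal
  -- is then immediate.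
  let G : ℝ → ℝ → ℝ := fun t s => ∑ k, Φ z k t * (∑ j, q k j * Ψ j l s + Ψ k l (min s t))
  have hsol : ∀ σ : ℝ → ℝ, IntegrableOn σ (Icc 0 T) →
      ((fun t => ∫ s in (0 : ℝ)..T, G t s * σ s) ∈ bvpSpace b n T ∧
        SolvesAE n T a (fun t => ∫ s in (0 : ℝ)..T, G t s * σ s) σ) := by
    intro σ hσ
    have hσi := (intervalIntegrable_iff_integrableOn_Icc_of_le hT.le).2 hσ
    have hΨσ := h.intervalIntegrable_inv_mul hT.le hσi
    set w : Fin (2 * n) → ℝ := fun k => ∫ s in 0..T, Ψ k l s * σ s with hw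
    obtain ⟨X, hX, hX0, hXT, hXs⟩ := h.exists_isJet hn hT.le hσi (κ w)
    have hXT' : (fun i : Fin (2 * n) => X i T) = transferMap Φ T (κ w + w) := by
      ext i; rw [hXT, transferMap_apply]; rfl
    refine (mem_bvpSpace_solvesAE_iff hn hT).2 ⟨X, ⟨?_, hX.primitive⟩, (hBC _ _).2 (by
      simp only [hX0, hXT']; exact hκB w), .of_forall fun t _ => hXs t⟩
    refine hX.zero.trans fun t ht => ?_
    have hmin : ContinuousOn (fun s => min s t) (uIcc 0 T) := by fun_prop
    have hmap : MapsTo (fun s => min s t) (uIcc 0 T) (Icc 0 T) := fun s hs => by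
      rw [uIcc_of_le hT.le] at hs
      exact ⟨le_min hs.1 ht.1, (min_le_right _ _).trans ht.2⟩
    have hΨm : ∀ k, IntervalIntegrable (fun s => Ψ k l (min s t) * σ s) volume 0 T := fun k =>
      hσi.continuousOn_mul ((hΨc k l).comp hmin hmap)
    have hI0 : IntervalIntegrable (fun s => (∑ k, Φ z k t * Ψ k l (min s t)) * σ s) volume 0 T := by
      refine hσi.continuousOn_mul ?_
      exact continuousOn_finsetSum _ fun k _ =>
        continuousOn_const.mul ((hΨc k l).comp hmin hmap)
    have hsub : uIcc 0 t ⊆ uIcc 0 T := by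
      rw [uIcc_of_le ht.1, uIcc_of_le hT.le]; exact Icc_subset_Icc le_rfl ht.2
    have hsub' : uIcc t T ⊆ uIcc 0 T := by
      rw [uIcc_of_le ht.2, uIcc_of_le hT.le]; exact Icc_subset_Icc ht.1 le_rfl
    have hvolterra : ∫ s in 0..T, (∑ k, Φ z k t * Ψ k l (min s t)) * σ s =
        ∑ k, Φ z k t * ∫ s in 0..t, Ψ k l s * σ s := by
      rw [← intervalIntegral.integral_add_adjacent_intervals (hI0.mono_set hsub)
        (hI0.mono_set hsub')]
      have h2 : ∫ s in t..T, (∑ k, Φ z k t * Ψ k l (min s t)) * σ s = 0 := by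
        rw [intervalIntegral.integral_congr (g := fun _ => 0), intervalIntegral.integral_zero]
        intro s hs
        rw [uIcc_of_le ht.2] at hs
        simp only [min_eq_right hs.1, h.mul_inv t ht, hzl, if_false, zero_mul]
      have h1 : ∫ s in 0..t, (∑ k, Φ z k t * Ψ k l (min s t)) * σ s =
          ∫ s in 0..t, ∑ k, Φ z k t * (Ψ k l s * σ s) := by
        refine intervalIntegral.integral_congr fun s hs => ?_
        rw [uIcc_of_le ht.1] at hs
        simp only [min_eq_left hs.2, Finset.sum_mul, mul_assoc]
      rw [h1, h2, add_zero, intervalIntegral.integral_finsetSum fun k _ =>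
        ((hΨσ k l).mono_set hsub).const_mul _]
      simp only [intervalIntegral.integral_const_mul]
    have hfredholm : ∫ s in 0..T, (∑ k, Φ z k t * ∑ j, q k j * (Ψ j l s * σ s)) =
        ∑ k, Φ z k t * κ w k := by
      rw [intervalIntegral.integral_finsetSum fun k _ => (intervalIntegrable_finset_sum _
        fun j _ => (hΨσ j l).const_mul _).const_mul _]
      refine Finset.sum_congr rfl fun k _ => ?_
      rw [intervalIntegral.integral_const_mul, intervalIntegral.integral_finsetSum fun j _ =>
        (hΨσ j l).const_mul _, hκq]
      simp only [intervalIntegral.integral_const_mul, hw]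
    calc ∑ k, Φ z k t * (κ w k + ∫ s in 0..t, Ψ k l s * σ s)
        = ∑ k, Φ z k t * κ w k + ∑ k, Φ z k t * ∫ s in 0..t, Ψ k l s * σ s := by
          simp only [mul_add, Finset.sum_add_distrib]
      _ = ∫ s in 0..T, ((∑ k, Φ z k t * ∑ j, q k j * (Ψ j l s * σ s)) +
            (∑ k, Φ z k t * Ψ k l (min s t)) * σ s) := by
          rw [intervalIntegral.integral_add (intervalIntegrable_finset_sum _ fun k _ =>
            (intervalIntegrable_finset_sum _ fun j _ => (hΨσ j l).const_mul _).const_mul _) hI0,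
            hvolterra, hfredholm]
      _ = ∫ s in 0..T, G t s * σ s := by
          congr 1
          ext s
          simp only [G, mul_add, Finset.sum_add_distrib, add_mul, Finset.sum_mul, Finset.mul_sum,
            mul_assoc]
  refine ⟨G, ?_, fun σ hσ => (hsol σ hσ).1, fun σ hσ => (hsol σ hσ).2⟩
  have hfst : MapsTo (Prod.fst : ℝ × ℝ → ℝ) (Icc 0 T ×ˢ Icc 0 T) (Icc 0 T) := fun p hp => hp.1
  have hsnd : MapsTo (Prod.snd : ℝ × ℝ → ℝ) (Icc 0 T ×ˢ Icc 0 T) (Icc 0 T) := fun p hp => hp.2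
  have hmin : MapsTo (fun p : ℝ × ℝ => min p.2 p.1) (Icc 0 T ×ˢ Icc 0 T) (Icc 0 T) := fun p hp =>
    ⟨le_min hp.2.1 hp.1.1, (min_le_right _ _).trans hp.1.2⟩
  refine continuousOn_finsetSum _ fun k _ =>
    ((hΦc z k).comp continuousOn_fst hfst).mul (.add ?_ ?_)
  · exact continuousOn_finsetSum _ fun j _ =>
      continuousOn_const.mul ((hΨc j l).comp continuousOn_snd hsnd)
  · exact (hΨc k l).comp (continuous_snd.min continuous_fst).continuousOn hmin

end Existence

/-! ### Operations on chains, and uniqueness of Green's functions -/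

namespace IsJet

variable {N : ℕ} {S T : ℝ} {u v : ℝ → ℝ} {x y : ℕ → ℝ → ℝ}

theorem add_const_mul (hu : IsJet N T u x) (hv : IsJet N T v y) (r : ℝ) :
    IsJet N T (fun t => u t + r * v t) (fun k t => x k t + r * y k t) where
  zero t ht := by simp only [hu.zero ht, hv.zero ht]
  primitive i hi := (hu.primitive i hi).add ((hv.primitive i hi).const_mul r)

theorem congr (hu : IsJet N T u x) (h : EqOn u v (Icc 0 T)) : IsJet N T v x :=
  ⟨hu.zero.trans h, hu.primitive⟩

theorem mono (hu : IsJet N S u x) (hT : 0 ≤ T) (hTS : T ≤ S) : IsJet N T u x :=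
  ⟨hu.zero.mono (Icc_subset_Icc le_rfl hTS), fun i hi => (hu.primitive i hi).mono le_rfl hT hTS⟩

theorem comp_sub_left (hu : IsJet N S u x) (hS : 0 ≤ S) :
    IsJet N S (fun t => u (S - t)) (fun k t => (-1) ^ k * x k (S - t)) where
  zero t ht := by simpa using hu.zero ⟨sub_nonneg.2 ht.2, sub_le_self S ht.1⟩
  primitive i hi :=
    (((hu.primitive i hi).comp_sub_left hS).const_mul ((-1) ^ i)).congr_right
      (.of_forall fun t _ => by ring)

end IsJet

theorem BoundaryCondition.JetHolds.add_const_mul {b : BoundaryCondition} {n : ℕ}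
    {p q p' q' : ℕ → ℝ} (h : b.JetHolds n p q) (h' : b.JetHolds n p' q') (r : ℝ) :
    b.JetHolds n (fun k => p k + r * p' k) (fun k => q k + r * q' k) := by
  cases b <;> intro k hk <;> simp only [h k hk, h' k hk]
  case antiperiodic => ring
  all_goals simp

section Uniqueness

variable {b : BoundaryCondition} {n : ℕ} {T : ℝ} {a : Fin (2 * n) → ℝ → ℝ} {G G' : ℝ → ℝ → ℝ}

theorem Nonresonant.eqOn (hb : Nonresonant b n T a) (hn : 1 ≤ n) (hT : 0 < T) {u v σ : ℝ → ℝ}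
    (hu : u ∈ bvpSpace b n T ∧ SolvesAE n T a u σ) (hv : v ∈ bvpSpace b n T ∧ SolvesAE n T a v σ) :
    EqOn u v (Icc 0 T) := by
  obtain ⟨x, hx, hxb, hxs⟩ := (mem_bvpSpace_solvesAE_iff hn hT).1 hu
  obtain ⟨y, hy, hyb, hys⟩ := (mem_bvpSpace_solvesAE_iff hn hT).1 hv
  have h := (mem_bvpSpace_solvesAE_iff (σ := fun _ => 0) hn hT).2
    ⟨_, hx.add_const_mul hy (-1), hxb.add_const_mul hyb (-1), by
      filter_upwards [hxs, hys] with t h1 h2 hm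
      have h3 : x (2 * n) t + ∑ k : Fin (2 * n), a k t * x k t -
          (y (2 * n) t + ∑ k : Fin (2 * n), a k t * y k t) = 0 := by
        rw [h1 hm, h2 hm, sub_self]
      simp only [mul_add, Finset.sum_add_distrib, ← h3, neg_one_mul, mul_neg,
        Finset.sum_neg_distrib]
      ring⟩
  intro t ht
  linarith [hb _ h.1 h.2 t ht]

theorem ContinuousOn.eq_zero_of_integral_sq {f : ℝ → ℝ} (hT : 0 < T)
    (hf : ContinuousOn f (Icc 0 T)) (h : ∫ s in 0..T, f s * f s = 0) : ∀ s ∈ Icc 0 T, f s = 0 := by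
  intro s hs
  by_contra hne
  exact (intervalIntegral.integral_pos hT (hf.mul hf) (fun s _ => mul_self_nonneg _)
    ⟨s, hs, mul_self_pos.2 hne⟩).ne' h

theorem IsGreenFunction.continuousOn_right (hG : IsGreenFunction b n T a G) {t : ℝ}
    (ht : t ∈ Icc 0 T) : ContinuousOn (G t) (Icc 0 T) :=
  hG.continuousOn.comp (f := fun s => (t, s)) (by fun_prop) fun _ hs => ⟨ht, hs⟩

theorem IsGreenFunction.intervalIntegrable_mul (hG : IsGreenFunction b n T a G) (hT : 0 ≤ T) {t : ℝ}
    (ht : t ∈ Icc 0 T) {σ : ℝ → ℝ} (hσ : IntervalIntegrable σ volume 0 T) :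
    IntervalIntegrable (fun s => G t s * σ s) volume 0 T :=
  hσ.continuousOn_mul (by rw [uIcc_of_le hT]; exact hG.continuousOn_right ht)

/-- For fixed `t`, test with `σ = G t - G' t` itself: both kernels give the same solution, so the
integral of `σ²` is zero, and `σ` is continuous. -/
theorem IsGreenFunction.unique (hG : IsGreenFunction b n T a G) (hG' : IsGreenFunction b n T a G')
    (hb : Nonresonant b n T a) (hn : 1 ≤ n) (hT : 0 < T) :
    ∀ t ∈ Icc 0 T, ∀ s ∈ Icc 0 T, G t s = G' t s := by
  intro t ht s hs
  have hc := (hG.continuousOn_right ht).sub (hG'.continuousOn_right ht)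
  set σ : ℝ → ℝ := fun s => G t s - G' t s
  have hσ : IntegrableOn σ (Icc 0 T) := hc.integrableOn_Icc
  have hσi := (intervalIntegrable_iff_integrableOn_Icc_of_le hT.le).2 hσ
  have h := hb.eqOn hn hT ⟨hG.mem_space σ hσ, hG.solves σ hσ⟩
    ⟨hG'.mem_space σ hσ, hG'.solves σ hσ⟩ ht
  refine sub_eq_zero.1 (hc.eq_zero_of_integral_sq hT ?_ s hs)
  change ∫ s in 0..T, (G t s - G' t s) * σ s = 0
  simp only [sub_mul]
  rw [intervalIntegral.integral_sub (hG.intervalIntegrable_mul hT.le ht hσi)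
    (hG'.intervalIntegrable_mul hT.le ht hσi)]
  exact sub_eq_zero.2 h

theorem Nonresonant.isGreenFunction (hb : Nonresonant b n T a) (hn : 1 ≤ n) (hT : 0 < T)
    (ha : ∀ k, IntegrableOn (a k) (Icc 0 T)) : IsGreenFunction b n T a (greenFunction b n T a) := by
  have h := hb.exists_isGreenFunction hn hT ha
  rw [greenFunction, dif_pos h]
  exact h.choose_spec

theorem Nonresonant.isUniqueGreenFunction (hb : Nonresonant b n T a) (hn : 1 ≤ n) (hT : 0 < T)
    (ha : ∀ k, IntegrableOn (a k) (Icc 0 T)) :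
    IsUniqueGreenFunction b n T a (greenFunction b n T a) :=
  ⟨hb.isGreenFunction hn hT ha, fun _ hG' => hG'.unique (hb.isGreenFunction hn hT ha) hb hn hT⟩

theorem Nonresonant.greenFunction_eq (hb : Nonresonant b n T a) (hn : 1 ≤ n) (hT : 0 < T)
    (ha : ∀ k, IntegrableOn (a k) (Icc 0 T)) (hG : IsGreenFunction b n T a G) :
    ∀ t ∈ Icc 0 T, ∀ s ∈ Icc 0 T, greenFunction b n T a t s = G t s :=
  (hb.isGreenFunction hn hT ha).unique hG hb hn hT

end Uniqueness

/-! ### Folding about the midpoint -/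

section Reflection

variable {n : ℕ} {T : ℝ} {a : Fin (2 * n) → ℝ → ℝ}

theorem integrableOn_extendCoeff (hT : 0 ≤ T) (ha : ∀ k, IntegrableOn (a k) (Icc 0 T))
    (k : Fin (2 * n)) : IntegrableOn (extendCoeff T a k) (Icc 0 (2 * T)) := by
  rw [← intervalIntegrable_iff_integrableOn_Icc_of_le (by linarith)]
  have h := (intervalIntegrable_iff_integrableOn_Icc_of_le hT).2 (ha k)
  refine IntervalIntegrable.trans (b := T) (h.congr fun t ht => ?_) ?_
  · rw [uIoc_of_le hT] at ht
    simp [extendCoeff, ht.2]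
  · have h2 := (h.comp_sub_left (2 * T)).symm.const_mul ((-1) ^ (k : ℕ))
    rw [sub_zero, show 2 * T - T = T by ring] at h2
    refine h2.congr fun t ht => ?_
    rw [uIoc_of_le (by linarith)] at ht
    simp [extendCoeff, not_le.2 ht.1]

/-- Even (`ε = 1`) or odd (`ε = -1`) reflection about the midpoint turns the boundary conditions
`b` into `b'` on the left half; `p`, `m`, `q` are jets at the left end, midpoint and right end. -/
def BoundaryCondition.FoldsTo (b : BoundaryCondition) (ε : ℝ) (b' : BoundaryCondition) (n : ℕ) :
    Prop :=
  ∀ p m q : ℕ → ℝ, b.JetHolds n p q →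
    b'.JetHolds n (fun k => p k + ε * ((-1) ^ k * q k)) (fun k => m k + ε * ((-1) ^ k * m k))

namespace BoundaryCondition

/-- In this and the next seven lemmas the condition at the midpoint depends on `ε` alone: `m k + ε
(-1)^k m k` vanishes for odd `k` if `ε = 1` and for even `k` if `ε = -1`. Only the condition at the
left end uses `b`. -/
theorem periodic_foldsTo_neumann : periodic.FoldsTo 1 neumann n := fun p m q h k hk => by
  simp [pow_succ, pow_mul, h (2 * k + 1) (by omega)]

theorem periodic_foldsTo_dirichlet : periodic.FoldsTo (-1) dirichlet n := fun p m q h k hk => by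
  simp [pow_mul, h (2 * k) (by omega)]

theorem neumann_foldsTo_neumann : neumann.FoldsTo 1 neumann n := fun p m q h k hk => by
  simp [pow_succ, pow_mul, h k hk]

theorem dirichlet_foldsTo_dirichlet : dirichlet.FoldsTo (-1) dirichlet n := fun p m q h k hk => by
  simp [pow_mul, h k hk]

theorem antiperiodic_foldsTo_mixed1 : antiperiodic.FoldsTo (-1) mixed1 n := fun p m q h k hk => by
  simp [pow_succ, pow_mul, h (2 * k + 1) (by omega)]

theorem antiperiodic_foldsTo_mixed2 : antiperiodic.FoldsTo 1 mixed2 n := fun p m q h k hk => by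
  simp [pow_succ, pow_mul, h (2 * k) (by omega)]

theorem neumann_foldsTo_mixed1 : neumann.FoldsTo (-1) mixed1 n := fun p m q h k hk => by
  simp [pow_succ, pow_mul, h k hk]

theorem dirichlet_foldsTo_mixed2 : dirichlet.FoldsTo 1 mixed2 n := fun p m q h k hk => by
  simp [pow_succ, pow_mul, h k hk]

end BoundaryCondition

/-- Superposing a solution on `[0,2T]` and its reflection solves the folded problem. No nonresonance
is needed, so folds can be composed freely. -/
theorem IsGreenFunction.fold {b b' : BoundaryCondition} {ε : ℝ} {G : ℝ → ℝ → ℝ}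
    (hG : IsGreenFunction b n (2 * T) (extendCoeff T a) G) (hbb' : b.FoldsTo ε b' n)
    (hn : 1 ≤ n) (hT : 0 < T) :
    IsGreenFunction b' n T a (fun t s => G t s + ε * G (2 * T - t) s) := by
  have hT2 : 0 < 2 * T := by linarith
  have hTT : T ≤ 2 * T := by linarith
  have hl : ∀ t ∈ Icc 0 T, t ∈ Icc 0 (2 * T) := fun t ht => ⟨ht.1, ht.2.trans hTT⟩
  have hr : ∀ t ∈ Icc 0 T, 2 * T - t ∈ Icc 0 (2 * T) := fun t ht =>
    ⟨by linarith [ht.2], by linarith [ht.1]⟩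
  have hsol : ∀ σ : ℝ → ℝ, IntegrableOn σ (Icc 0 T) →
      ((fun t => ∫ s in (0 : ℝ)..T, (G t s + ε * G (2 * T - t) s) * σ s) ∈ bvpSpace b' n T ∧
        SolvesAE n T a (fun t => ∫ s in (0 : ℝ)..T, (G t s + ε * G (2 * T - t) s) * σ s) σ) := by
    intro σ hσ
    -- Extension by zero leaves the reflected function without a source on `(0,T)`, and reduces the
    -- integral over `[0,2T]` to one over `[0,T]`.
    set τ : ℝ → ℝ := (Icc 0 T).indicator σ with hτ
    have hτ0 : ∀ t ∉ Icc 0 T, τ t = 0 := fun t ht => indicator_of_notMem ht σ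
    have hτσ : ∀ t ∈ Icc 0 T, τ t = σ t := fun t ht => indicator_of_mem ht σ
    have hτi : Integrable τ := (integrable_indicator_iff measurableSet_Icc).2 hσ
    have hτ1 : IntervalIntegrable τ volume 0 T := hτi.intervalIntegrable
    have hτ2 : IntervalIntegrable τ volume 0 (2 * T) := hτi.intervalIntegrable
    obtain ⟨x, hx, hxb, hxs⟩ := (mem_bvpSpace_solvesAE_iff hn hT2).1
      ⟨hG.mem_space τ hτi.integrableOn, hG.solves τ hτi.integrableOn⟩
    have hint : ∀ t ∈ Icc 0 (2 * T), IntervalIntegrable (fun s => G t s * σ s) volume 0 T ∧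
        ∫ s in 0..(2 * T), G t s * τ s = ∫ s in 0..T, G t s * σ s := by
      intro t ht
      have hI := hG.intervalIntegrable_mul hT2.le ht hτ2
      have hI1 : IntervalIntegrable (fun s => G t s * τ s) volume 0 T := hI.mono_set (by
        rw [uIcc_of_le hT.le, uIcc_of_le hT2.le]; exact Icc_subset_Icc le_rfl hTT)
      have hI2 : IntervalIntegrable (fun s => G t s * τ s) volume T (2 * T) := hI.mono_set (by
        rw [uIcc_of_le hTT, uIcc_of_le hT2.le]; exact Icc_subset_Icc hT.le le_rfl)
      have h0 : ∫ s in T..(2 * T), G t s * τ s = 0 := by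
        refine intervalIntegral.integral_zero_ae (.of_forall fun s hs => ?_)
        rw [uIoc_of_le hTT] at hs
        rw [hτ0 s fun h => hs.1.not_ge h.2, mul_zero]
      refine ⟨hI1.congr fun s hs => ?_, ?_⟩
      · rw [uIoc_of_le hT.le] at hs
        simp only [hτσ s (Ioc_subset_Icc_self hs)]
      · rw [← intervalIntegral.integral_add_adjacent_intervals hI1 hI2, h0, add_zero]
        refine intervalIntegral.integral_congr fun s hs => ?_
        rw [uIcc_of_le hT.le] at hs
        simp only [hτσ s hs]
    have hj := (hx.add_const_mul (hx.comp_sub_left hT2.le) ε).mono hT.le hTT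
    refine (mem_bvpSpace_solvesAE_iff hn hT).2 ⟨_, hj.congr fun t ht => ?_, ?_, ?_⟩
    · simp only [(hint t (hl t ht)).2, (hint _ (hr t ht)).2, add_mul, mul_assoc]
      rw [intervalIntegral.integral_add (hint t (hl t ht)).1 ((hint _ (hr t ht)).1.const_mul ε),
        intervalIntegral.integral_const_mul]
    · have := hbb' _ (fun k => x k T) _ hxb
      simpa only [sub_zero, show 2 * T - T = T by ring] using this
    -- The equation at the reflected point also holds for almost every `t`, as reflection preserves
    -- Lebesgue measure.
    · have hxr : ∀ᵐ t, 2 * T - t ∈ Ioo 0 (2 * T) → x (2 * n) (2 * T - t) +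
          ∑ k : Fin (2 * n), extendCoeff T a k (2 * T - t) * x k (2 * T - t) = τ (2 * T - t) :=
        (Measure.measurePreserving_sub_left volume (2 * T)).quasiMeasurePreserving.ae hxs
      filter_upwards [hxs, hxr] with t h1 h2 ht
      have e1 := h1 ⟨ht.1, ht.2.trans_le hTT⟩
      have e2 := h2 ⟨by linarith [ht.2], by linarith [ht.1]⟩
      rw [hτσ t (Ioo_subset_Icc_self ht)] at e1
      rw [hτ0 _ fun h => by linarith [h.2, ht.2]] at e2
      have c1 : ∀ k, extendCoeff T a k t = a k t := fun k => by simp [extendCoeff, ht.2.le]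
      have c2 : ∀ k : Fin (2 * n), extendCoeff T a k (2 * T - t) = (-1) ^ (k : ℕ) * a k t :=
        fun k => by
          have : ¬ 2 * T - t ≤ T := by linarith [ht.2]
          simp [extendCoeff, this]
      simp only [c1] at e1
      simp only [c2] at e2
      -- The sign `(-1)^k` from differentiating the reflection is absorbed as the sign of the
      -- extended coefficient at `2T - t`; the leading term has even order and no sign.
      calc _ = (x (2 * n) t + ∑ k : Fin (2 * n), a k t * x k t) + ε * (x (2 * n) (2 * T - t) +
            ∑ k : Fin (2 * n), (-1) ^ (k : ℕ) * a k t * x k (2 * T - t)) := by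
            simp only [mul_add, Finset.sum_add_distrib, Finset.mul_sum, pow_mul, even_two,
              Even.neg_pow, one_pow, one_mul]
            have : ∀ k : Fin (2 * n), a k t * (ε * ((-1) ^ (k : ℕ) * x k (2 * T - t))) =
                ε * ((-1) ^ (k : ℕ) * a k t * x k (2 * T - t)) := fun k => by ring
            simp only [this]
            ring
        _ = σ t := by rw [e1, e2, mul_zero, add_zero]
  refine ⟨?_, fun σ hσ => (hsol σ hσ).1, fun σ hσ => (hsol σ hσ).2⟩
  refine (hG.continuousOn.mono (prod_mono (fun t => hl t) (fun t => hl t))).add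
    (continuousOn_const.mul ?_)
  exact hG.continuousOn.comp (f := fun p : ℝ × ℝ => (2 * T - p.1, p.2)) (by fun_prop)
    fun p hp => ⟨hr _ hp.1, hl _ hp.2⟩

end Reflection

/-! ### The formulas -/

theorem mainTheorem1 (n : ℕ) (hn : 1 ≤ n) (T : ℝ) (hT : 0 < T) (a : Fin (2 * n) → ℝ → ℝ)
    (ha : ∀ k, IntegrableOn (a k) (Icc 0 T))
    (a₂ a₄ : Fin (2 * n) → ℝ → ℝ)
    (ha₂ : a₂ = extendCoeff T a) (ha₄ : a₄ = extendCoeff (2 * T) a₂) :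
      -- under nonresonance, each of the Green's functions exists and is unique
      (∀ b : BoundaryCondition,
        (Nonresonant b n T a →
          IsUniqueGreenFunction b n T a (greenFunction b n T a)) ∧
        (Nonresonant b n (2 * T) a₂ →
          IsUniqueGreenFunction b n (2 * T) a₂ (greenFunction b n (2 * T) a₂)) ∧
        (Nonresonant b n (4 * T) a₄ →
          IsUniqueGreenFunction b n (4 * T) a₄ (greenFunction b n (4 * T) a₄))) ∧
      -- Neumann on `[0,T]` from periodic on `[0,2T]`
      (Nonresonant .neumann n T a →
        Nonresonant .periodic n (2 * T) a₂ →
        ∀ t ∈ Icc 0 T, ∀ s ∈ Icc 0 T,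
          greenFunction .neumann n T a t s =
            greenFunction .periodic n (2 * T) a₂ t s +
              greenFunction .periodic n (2 * T) a₂ (2 * T - t) s) ∧
      -- Neumann on `[0,T]` from Neumann on `[0,2T]`
      (Nonresonant .neumann n T a →
        Nonresonant .neumann n (2 * T) a₂ →
        ∀ t ∈ Icc 0 T, ∀ s ∈ Icc 0 T,
          greenFunction .neumann n T a t s =
            greenFunction .neumann n (2 * T) a₂ t s +
              greenFunction .neumann n (2 * T) a₂ (2 * T - t) s) ∧
      -- Neumann on `[0,T]` from periodic on `[0,4T]`
      (Nonresonant .neumann n T a →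
        Nonresonant .periodic n (4 * T) a₄ →
        ∀ t ∈ Icc 0 T, ∀ s ∈ Icc 0 T,
          greenFunction .neumann n T a t s =
            greenFunction .periodic n (4 * T) a₄ t s +
              greenFunction .periodic n (4 * T) a₄ (4 * T - t) s +
              greenFunction .periodic n (4 * T) a₄ (2 * T - t) s +
              greenFunction .periodic n (4 * T) a₄ (2 * T + t) s) ∧
      -- Dirichlet on `[0,T]` from periodic on `[0,2T]`
      (Nonresonant .dirichlet n T a →
        Nonresonant .periodic n (2 * T) a₂ →
        ∀ t ∈ Icc 0 T, ∀ s ∈ Icc 0 T,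
          greenFunction .dirichlet n T a t s =
            greenFunction .periodic n (2 * T) a₂ t s -
              greenFunction .periodic n (2 * T) a₂ (2 * T - t) s) ∧
      -- Dirichlet on `[0,T]` from Dirichlet on `[0,2T]`
      (Nonresonant .dirichlet n T a →
        Nonresonant .dirichlet n (2 * T) a₂ →
        ∀ t ∈ Icc 0 T, ∀ s ∈ Icc 0 T,
          greenFunction .dirichlet n T a t s =
            greenFunction .dirichlet n (2 * T) a₂ t s -
              greenFunction .dirichlet n (2 * T) a₂ (2 * T - t) s) ∧
      -- Dirichlet on `[0,T]` from periodic on `[0,4T]`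
      (Nonresonant .dirichlet n T a →
        Nonresonant .periodic n (4 * T) a₄ →
        ∀ t ∈ Icc 0 T, ∀ s ∈ Icc 0 T,
          greenFunction .dirichlet n T a t s =
            greenFunction .periodic n (4 * T) a₄ t s -
              greenFunction .periodic n (4 * T) a₄ (4 * T - t) s -
              greenFunction .periodic n (4 * T) a₄ (2 * T - t) s +
              greenFunction .periodic n (4 * T) a₄ (2 * T + t) s) ∧
      -- mixed 1 on `[0,T]` from antiperiodic on `[0,2T]`
      (Nonresonant .mixed1 n T a →
        Nonresonant .antiperiodic n (2 * T) a₂ →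
        ∀ t ∈ Icc 0 T, ∀ s ∈ Icc 0 T,
          greenFunction .mixed1 n T a t s =
            greenFunction .antiperiodic n (2 * T) a₂ t s -
              greenFunction .antiperiodic n (2 * T) a₂ (2 * T - t) s) ∧
      -- mixed 2 on `[0,T]` from antiperiodic on `[0,2T]`
      (Nonresonant .mixed2 n T a →
        Nonresonant .antiperiodic n (2 * T) a₂ →
        ∀ t ∈ Icc 0 T, ∀ s ∈ Icc 0 T,
          greenFunction .mixed2 n T a t s =
            greenFunction .antiperiodic n (2 * T) a₂ t s +
              greenFunction .antiperiodic n (2 * T) a₂ (2 * T - t) s) ∧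
      -- mixed 1 on `[0,T]` from Neumann on `[0,2T]`
      (Nonresonant .mixed1 n T a →
        Nonresonant .neumann n (2 * T) a₂ →
        ∀ t ∈ Icc 0 T, ∀ s ∈ Icc 0 T,
          greenFunction .mixed1 n T a t s =
            greenFunction .neumann n (2 * T) a₂ t s -
              greenFunction .neumann n (2 * T) a₂ (2 * T - t) s) ∧
      -- mixed 2 on `[0,T]` from Dirichlet on `[0,2T]`
      (Nonresonant .mixed2 n T a →
        Nonresonant .dirichlet n (2 * T) a₂ →
        ∀ t ∈ Icc 0 T, ∀ s ∈ Icc 0 T,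
          greenFunction .mixed2 n T a t s =
            greenFunction .dirichlet n (2 * T) a₂ t s +
              greenFunction .dirichlet n (2 * T) a₂ (2 * T - t) s) ∧
      -- mixed 1 on `[0,T]` from periodic on `[0,4T]`
      (Nonresonant .mixed1 n T a →
        Nonresonant .periodic n (4 * T) a₄ →
        ∀ t ∈ Icc 0 T, ∀ s ∈ Icc 0 T,
          greenFunction .mixed1 n T a t s =
            greenFunction .periodic n (4 * T) a₄ t s +
              greenFunction .periodic n (4 * T) a₄ (4 * T - t) s -
              greenFunction .periodic n (4 * T) a₄ (2 * T - t) s -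
              greenFunction .periodic n (4 * T) a₄ (2 * T + t) s) ∧
      -- mixed 2 on `[0,T]` from periodic on `[0,4T]`
      (Nonresonant .mixed2 n T a →
        Nonresonant .periodic n (4 * T) a₄ →
        ∀ t ∈ Icc 0 T, ∀ s ∈ Icc 0 T,
          greenFunction .mixed2 n T a t s =
            greenFunction .periodic n (4 * T) a₄ t s -
              greenFunction .periodic n (4 * T) a₄ (4 * T - t) s +
              greenFunction .periodic n (4 * T) a₄ (2 * T - t) s -
              greenFunction .periodic n (4 * T) a₄ (2 * T + t) s) ∧
      -- periodic on `[0,2T]` from Neumann and Dirichlet on `[0,T]`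
      (Nonresonant .neumann n T a →
        Nonresonant .dirichlet n T a →
        Nonresonant .periodic n (2 * T) a₂ →
        ∀ t ∈ Icc 0 T, ∀ s ∈ Icc 0 T,
          greenFunction .periodic n (2 * T) a₂ t s =
            1 / 2 * (greenFunction .neumann n T a t s +
              greenFunction .dirichlet n T a t s) ∧
          greenFunction .periodic n (2 * T) a₂ (2 * T - t) s =
            1 / 2 * (greenFunction .neumann n T a t s -
              greenFunction .dirichlet n T a t s)) ∧
      -- antiperiodic on `[0,2T]` from mixed 2 and mixed 1 on `[0,T]`
      (Nonresonant .mixed2 n T a →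
        Nonresonant .mixed1 n T a →
        Nonresonant .antiperiodic n (2 * T) a₂ →
        ∀ t ∈ Icc 0 T, ∀ s ∈ Icc 0 T,
          greenFunction .antiperiodic n (2 * T) a₂ t s =
            1 / 2 * (greenFunction .mixed2 n T a t s +
              greenFunction .mixed1 n T a t s) ∧
          greenFunction .antiperiodic n (2 * T) a₂ (2 * T - t) s =
            1 / 2 * (greenFunction .mixed2 n T a t s -
              greenFunction .mixed1 n T a t s)) ∧
      -- Neumann on `[0,2T]` from Neumann and mixed 1 on `[0,T]`
      (Nonresonant .neumann n T a →
        Nonresonant .mixed1 n T a →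
        Nonresonant .neumann n (2 * T) a₂ →
        ∀ t ∈ Icc 0 T, ∀ s ∈ Icc 0 T,
          greenFunction .neumann n (2 * T) a₂ t s =
            1 / 2 * (greenFunction .neumann n T a t s +
              greenFunction .mixed1 n T a t s) ∧
          greenFunction .neumann n (2 * T) a₂ (2 * T - t) s =
            1 / 2 * (greenFunction .neumann n T a t s -
              greenFunction .mixed1 n T a t s)) ∧
      -- Dirichlet on `[0,2T]` from mixed 2 and Dirichlet on `[0,T]`
      (Nonresonant .mixed2 n T a →
        Nonresonant .dirichlet n T a →
        Nonresonant .dirichlet n (2 * T) a₂ →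
        ∀ t ∈ Icc 0 T, ∀ s ∈ Icc 0 T,
          greenFunction .dirichlet n (2 * T) a₂ t s =
            1 / 2 * (greenFunction .mixed2 n T a t s +
              greenFunction .dirichlet n T a t s) ∧
          greenFunction .dirichlet n (2 * T) a₂ (2 * T - t) s =
            1 / 2 * (greenFunction .mixed2 n T a t s -
              greenFunction .dirichlet n T a t s)) ∧
      -- periodic on `[0,4T]` from the four problems on `[0,T]`
      (Nonresonant .neumann n T a →
        Nonresonant .dirichlet n T a →
        Nonresonant .mixed1 n T a →
        Nonresonant .mixed2 n T a →
        Nonresonant .periodic n (4 * T) a₄ →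
        ∀ t ∈ Icc 0 T, ∀ s ∈ Icc 0 T,
          greenFunction .periodic n (4 * T) a₄ t s =
            1 / 4 * (greenFunction .neumann n T a t s + greenFunction .dirichlet n T a t s +
              greenFunction .mixed1 n T a t s + greenFunction .mixed2 n T a t s)) := by
  subst ha₂
  -- In this form `[0,4T]` is the double of `[0,2T]`, and folding applies twice.
  have h42 : 4 * T = 2 * (2 * T) := by ring
  have hT2 : 0 < 2 * T := by linarith
  have hI2 := integrableOn_extendCoeff hT.le ha
  have hI4 := integrableOn_extendCoeff hT2.le hI2
  simp only [h42]
  subst ha₄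
  have hT4 : 0 < 2 * (2 * T) := by linarith
  have two {b b' : BoundaryCondition} {ε : ℝ} (h : b.FoldsTo ε b' n)
      (h1 : Nonresonant b' n T a) (h2 : Nonresonant b n (2 * T) (extendCoeff T a)) :=
    h1.greenFunction_eq hn hT ha ((h2.isGreenFunction hn hT2 hI2).fold h hn hT)
  -- The intermediate problem `b'` on `[0,2T]` may be resonant: the first fold still gives a Green's
  -- function for it, and uniqueness is used only on `[0,T]`.
  have four {b b' b'' : BoundaryCondition} {ε δ : ℝ} (h : b.FoldsTo ε b' n)
      (h' : b'.FoldsTo δ b'' n) (h1 : Nonresonant b'' n T a)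
      (h2 : Nonresonant b n (2 * (2 * T)) (extendCoeff (2 * T) (extendCoeff T a))) :=
    h1.greenFunction_eq hn hT ha
      (((h2.isGreenFunction hn hT4 hI4).fold h hn hT2).fold h' hn hT)
  have refl4 (t : ℝ) : 2 * (2 * T) - (2 * T - t) = 2 * T + t := by ring
  open BoundaryCondition in
  refine ⟨fun b => ⟨fun h => h.isUniqueGreenFunction hn hT ha,
    fun h => h.isUniqueGreenFunction hn hT2 hI2, fun h => h.isUniqueGreenFunction hn hT4 hI4⟩,
    fun h1 h2 t ht s hs => ?_, fun h1 h2 t ht s hs => ?_, fun h1 h2 t ht s hs => ?_,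
    fun h1 h2 t ht s hs => ?_, fun h1 h2 t ht s hs => ?_, fun h1 h2 t ht s hs => ?_,
    fun h1 h2 t ht s hs => ?_, fun h1 h2 t ht s hs => ?_, fun h1 h2 t ht s hs => ?_,
    fun h1 h2 t ht s hs => ?_, fun h1 h2 t ht s hs => ?_, fun h1 h2 t ht s hs => ?_,
    fun h1 h2 h3 t ht s hs => ?_, fun h1 h2 h3 t ht s hs => ?_, fun h1 h2 h3 t ht s hs => ?_,
    fun h1 h2 h3 t ht s hs => ?_, fun h1 h2 h3 h4 h5 t ht s hs => ?_⟩
  · rw [two periodic_foldsTo_neumann h1 h2 t ht s hs]; ring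
  · rw [two neumann_foldsTo_neumann h1 h2 t ht s hs]; ring
  · rw [four periodic_foldsTo_neumann neumann_foldsTo_neumann h1 h2 t ht s hs, refl4]; ring
  · rw [two periodic_foldsTo_dirichlet h1 h2 t ht s hs]; ring
  · rw [two dirichlet_foldsTo_dirichlet h1 h2 t ht s hs]; ring
  · rw [four periodic_foldsTo_dirichlet dirichlet_foldsTo_dirichlet h1 h2 t ht s hs, refl4]; ring
  · rw [two antiperiodic_foldsTo_mixed1 h1 h2 t ht s hs]; ring
  · rw [two antiperiodic_foldsTo_mixed2 h1 h2 t ht s hs]; ring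
  · rw [two neumann_foldsTo_mixed1 h1 h2 t ht s hs]; ring
  · rw [two dirichlet_foldsTo_mixed2 h1 h2 t ht s hs]; ring
  · rw [four periodic_foldsTo_neumann neumann_foldsTo_mixed1 h1 h2 t ht s hs, refl4]; ring
  · rw [four periodic_foldsTo_dirichlet dirichlet_foldsTo_mixed2 h1 h2 t ht s hs, refl4]; ring
  -- For the connecting relations, each Green's function on `[0,T]` is expanded in the one on the
  -- larger interval; what remains is an algebraic identity.
  · rw [two periodic_foldsTo_neumann h1 h3 t ht s hs, two periodic_foldsTo_dirichlet h2 h3 t ht s hs]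
    constructor <;> ring
  · rw [two antiperiodic_foldsTo_mixed2 h1 h3 t ht s hs,
      two antiperiodic_foldsTo_mixed1 h2 h3 t ht s hs]
    constructor <;> ring
  · rw [two neumann_foldsTo_neumann h1 h3 t ht s hs, two neumann_foldsTo_mixed1 h2 h3 t ht s hs]
    constructor <;> ring
  · rw [two dirichlet_foldsTo_mixed2 h1 h3 t ht s hs,
      two dirichlet_foldsTo_dirichlet h2 h3 t ht s hs]
    constructor <;> ring
  · rw [four periodic_foldsTo_neumann neumann_foldsTo_neumann h1 h5 t ht s hs,
      four periodic_foldsTo_dirichlet dirichlet_foldsTo_dirichlet h2 h5 t ht s hs,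
      four periodic_foldsTo_neumann neumann_foldsTo_mixed1 h3 h5 t ht s hs,
      four periodic_foldsTo_dirichlet dirichlet_foldsTo_mixed2 h4 h5 t ht s hs]
    ring
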